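/- Let $c>0$ and $d$ be real constants. For a polynomial $p(x)=\sum_{i=0}^n p_i x^i=p_n\prod_{j=1}^n(x-x_j)$ of degree $n\ge 1$ with real coefficients and complex roots $x_1,\dots,x_n$ (listed with multiplicity), let $r_1\ge r_2\ge\cdots\ge r_n$ denote its root radii, that is, the numbers $|x_1|,\dots,|x_n|$ arranged in nonincreasing order. Then there is an algorithm (a single one for all $n$ and all $p$, depending only on $c$ and $d$) that, given $n$ and the coefficients $p_0,\dots,p_n$ of such a polynomial, computes $n$ real numbers $\tilde r_1,\dots,\tilde r_n$ such that $$\tilde r_j\le r_j\le \Bigl(1+\frac{c}{n^d}\Bigr)\tilde r_j,\qquad j=1,\dots,n,$$ and uses $O(n\log^2 n)$ arithmetic operations as $n\to\infty$, with a constant that depends only on $c$ and $d$. Here the computation is exact, on a real random access machine; the operations are $+,-,\times,\div$ and comparisons of real numbers and the extraction of the nonnegative $m$-th root of a nonnegative real number for an integer $m\ge 1$, each counted as one operation. (The bound even covers all executed instructions, including the handling of integer indices and of loops.) -/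

import Mathlib

/-!
A real random access machine.  A state has two memories, one of exact real numbers and one of
natural numbers; the latter is used for addresses, counters and root indices only.  Programs are
finite, contain no real constants, and information passes from the reals to the naturals only
through comparisons.  All loops are bounded, so that every program halts on every input.
-/

namespace RealRAM

/-- The memory of the machine: cells for natural numbers and cells for real numbers. -/
@[ext]
structure State where
  nats : ℕ → ℕ
  reals : ℕ → ℝ

/-- Address (index) expressions; `sub` is truncated, `div` and `mod` are those of `ℕ`. -/
inductive NatExpr where
  | lit (k : ℕ)
  | load (a : NatExpr)
  | add (a b : NatExpr)
  | sub (a b : NatExpr)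
  | mul (a b : NatExpr)
  | div (a b : NatExpr)
  | mod (a b : NatExpr)

/-- The value of an address expression; `load a` is the content of the natural number cell `a`. -/
def NatExpr.eval (s : State) : NatExpr → ℕ
  | lit k => k
  | load a => s.nats (a.eval s)
  | add a b => a.eval s + b.eval s
  | sub a b => a.eval s - b.eval s
  | mul a b => a.eval s * b.eval s
  | div a b => a.eval s / b.eval s
  | mod a b => a.eval s % b.eval s

/-- The four arithmetic operations. -/
inductive ArithOp where
  | add
  | sub
  | mul
  | div

/-- The exact result of an arithmetic operation; division by zero returns zero. -/
noncomputable def ArithOp.eval : ArithOp → ℝ → ℝ → ℝ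
  | add, x, y => x + y
  | sub, x, y => x - y
  | mul, x, y => x * y
  | div, x, y => x / y

/-- The nonnegative `m`-th root of a nonnegative real number, for `m ≥ 1`; zero otherwise. -/
noncomputable def rootOp (m : ℕ) (x : ℝ) : ℝ :=
  if 1 ≤ m ∧ 0 ≤ x then x ^ ((m : ℝ)⁻¹) else 0

/-- Programs. -/
inductive Prog where
  /-- do nothing -/
  | skip
  /-- `N[dst] := e` -/
  | setNat (dst e : NatExpr)
  /-- `R[dst] := e`, the natural number `e` being regarded as a real number -/
  | setReal (dst e : NatExpr)
  /-- `R[dst] := R[a]` -/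
  | copy (dst a : NatExpr)
  /-- `R[dst] := R[a] op R[b]` -/
  | arith (op : ArithOp) (dst a b : NatExpr)
  /-- `R[dst] :=` the `m`-th root of `R[a]` -/
  | root (dst m a : NatExpr)
  /-- `P; Q` -/
  | seq (P Q : Prog)
  /-- if `a ≤ b` then `P` else `Q` -/
  | ifNat (a b : NatExpr) (P Q : Prog)
  /-- if `R[a] ≤ R[b]` then `P` else `Q` -/
  | ifReal (a b : NatExpr) (P Q : Prog)
  /-- evaluate `e` once, then execute `P` that many times -/
  | loop (e : NatExpr) (P : Prog)

/-- Store a natural number. -/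
def State.storeNat (s : State) (i v : ℕ) : State :=
  { s with nats := Function.update s.nats i v }

/-- Store a real number. -/
noncomputable def State.storeReal (s : State) (i : ℕ) (v : ℝ) : State :=
  { s with reals := Function.update s.reals i v }

/-- The state after the execution of a program. -/
noncomputable def Prog.run : Prog → State → State
  | skip, s => s
  | setNat dst e, s => s.storeNat (dst.eval s) (e.eval s)
  | setReal dst e, s => s.storeReal (dst.eval s) (e.eval s : ℝ)
  | copy dst a, s => s.storeReal (dst.eval s) (s.reals (a.eval s))
  | arith op dst a b, s =>
      s.storeReal (dst.eval s) (op.eval (s.reals (a.eval s)) (s.reals (b.eval s)))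
  | root dst m a, s => s.storeReal (dst.eval s) (rootOp (m.eval s) (s.reals (a.eval s)))
  | seq P Q, s => Q.run (P.run s)
  | ifNat a b P Q, s => if a.eval s ≤ b.eval s then P.run s else Q.run s
  | ifReal a b P Q, s =>
      if s.reals (a.eval s) ≤ s.reals (b.eval s) then P.run s else Q.run s
  | loop e P, s => P.run^[e.eval s] s

/-- The number of instructions executed by a program.  Every assignment (also of natural
numbers), arithmetic operation, root extraction and comparison, every start of a loop and every
pass through a loop counts one, so that in particular the number of operations on real numbers
is at most this number. -/
noncomputable def Prog.cost : Prog → State → ℕ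
  | skip, _ => 0
  | setNat _ _, _ => 1
  | setReal _ _, _ => 1
  | copy _ _, _ => 1
  | arith _ _ _ _, _ => 1
  | root _ _ _, _ => 1
  | seq P Q, s => P.cost s + Q.cost (P.run s)
  | ifNat a b P Q, s => 1 + if a.eval s ≤ b.eval s then P.cost s else Q.cost s
  | ifReal a b P Q, s =>
      1 + if s.reals (a.eval s) ≤ s.reals (b.eval s) then P.cost s else Q.cost s
  | loop e P, s => 1 + ∑ i ∈ Finset.range (e.eval s), (1 + P.cost (P.run^[i] s))

/-- The initial state for a real polynomial `p`: its degree is in the natural number cell `0`,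
its coefficients `p_0, p_1, …, p_n` are in the real cells `0, 1, …, n`; all other cells hold `0`. -/
noncomputable def inputState (p : Polynomial ℝ) : State where
  nats := fun i => if i = 0 then p.natDegree else 0
  reals := fun i => p.coeff i

end RealRAM

/-- The absolute values of the complex roots of `p`, repeated according to multiplicity, in
nonincreasing order. -/
noncomputable def rootRadii (p : Polynomial ℝ) : List ℝ :=
  ((p.map (algebraMap ℝ ℂ)).roots.map fun x => ‖x‖).sort (· ≥ ·)

/-- A polynomial of degree `n` has `n` root radii. -/
theorem length_rootRadii (p : Polynomial ℝ) : (rootRadii p).length = p.natDegree := by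
  simp only [rootRadii, Multiset.length_sort, Multiset.card_map]
  rw [IsAlgClosed.card_roots_eq_natDegree, Polynomial.natDegree_map]

/-- The root radius `r_{j+1}` of `p`, for `0 ≤ j < deg p`, so that `r_1 ≥ r_2 ≥ ⋯ ≥ r_n`. -/
noncomputable def rootRadius (p : Polynomial ℝ) (j : Fin p.natDegree) : ℝ :=
  (rootRadii p).get (j.cast (length_rootRadii p).symm)

/-!
If all roots of `p` are replaced by their `M`-th powers, then an approximation of the root radii up
to a factor `4 ^ n` becomes, after the extraction of `M`-th roots, one up to `4 ^ (n / M)`.  For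
`M = 2 ^ k` such a polynomial `q` arises from `k` root squarings `q ↦ q(√x) q(-√x)`; an error
`c / n ^ d` requires only `k = O(log n)` of them, and each one takes `O(n log n)` operations by
means of the fast Fourier transform.  Since programs contain no real constants, the root of unity
is computed by the half-angle formulas.

For `q` a factor `4 ^ n` is available at once: the Mahler measure of `q(tx)`, which is the product
of `|q_n|` and the numbers `max t |x|` for all roots `x` of `q`, agrees with the largest of the
numbers `|q_i| t ^ i` up to a factor `2 ^ n`.  Hence the slopes of the Newton polygon of the weights
`|q_i|`, which is computed by a linear scan with a stack, are close to the root radii of `q`.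
Division by `1 + 1 / E`, with `E` of order `n ^ d / c`, finally turns the two-sided approximation
into a lower bound.
-/

open Polynomial

/-! ### Root squaring -/

/-- The Graeffe transform of `q`: the polynomial in `x ^ 2` that equals `q(x) q(-x)`. -/
noncomputable def graeffe {R : Type*} [CommRing R] (q : R[X]) : R[X] :=
  contract 2 (q * q.comp (-X))

theorem coeff_graeffe {R : Type*} [CommRing R] (q : R[X]) (i : ℕ) :
    (graeffe q).coeff i = (q * q.comp (-X)).coeff (2 * i) := by
  rw [graeffe, coeff_contract two_ne_zero, mul_comm i]

theorem map_graeffe {R S : Type*} [CommRing R] [CommRing S] (φ : R →+* S) (q : R[X]) :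
    (graeffe q).map φ = graeffe (q.map φ) := by
  simp only [graeffe, map_contract two_ne_zero, Polynomial.map_mul, Polynomial.map_comp,
    Polynomial.map_neg, map_X]

section Splits

variable {K : Type*} [Field K] {f : K[X]}

theorem mul_comp_neg_X_of_splits (hf : f.Splits) :
    f * f.comp (-X) = expand K 2 (C ((-1) ^ f.roots.card * f.leadingCoeff ^ 2) *
      ((f.roots.map (· ^ 2)).map fun x => X - C x).prod) := by
  have neg_one_pow : C ((-1 : K) ^ f.roots.card) = (f.roots.map fun _ => (-1 : K[X])).prod := by
    simp only [map_pow, map_neg, map_one, Multiset.map_const', Multiset.prod_replicate]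
  have linear_factors : (f.roots.map fun x => X - C x).prod *
      (f.roots.map fun x => (X - C x).comp (-X)).prod =
      C ((-1) ^ f.roots.card) * (f.roots.map fun x => expand K 2 (X - C (x ^ 2))).prod := by
    rw [neg_one_pow, ← Multiset.prod_map_mul, ← Multiset.prod_map_mul]
    refine congrArg _ (Multiset.map_congr rfl fun x _ => ?_)
    simp only [sub_comp, X_comp, C_comp, map_sub, expand_X, expand_C]
    rw [C_pow]
    ring
  conv_lhs => rw [hf.eq_prod_roots]
  rw [mul_comp, multiset_prod_comp, C_comp, map_mul, map_multiset_prod, expand_C]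
  simp only [Multiset.map_map, Function.comp_def]
  rw [mul_mul_mul_comm, linear_factors]
  simp only [C_mul, C_pow]
  ring

theorem graeffe_of_splits (hf : f.Splits) :
    graeffe f = C ((-1) ^ f.roots.card * f.leadingCoeff ^ 2) *
      ((f.roots.map (· ^ 2)).map fun x => X - C x).prod := by
  rw [graeffe, mul_comp_neg_X_of_splits hf, contract_expand _ two_ne_zero]

theorem roots_graeffe (hf : f.Splits) : (graeffe f).roots = f.roots.map (· ^ 2) := by
  rcases eq_or_ne f 0 with rfl | h0
  · rw [graeffe, zero_mul, ← C_0, contract_C, C_0, roots_zero, Multiset.map_zero]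
  · rw [graeffe_of_splits hf, roots_C_mul, roots_multiset_prod_X_sub_C]
    simpa using h0

theorem graeffe_ne_zero (hf : f.Splits) (h0 : f ≠ 0) : graeffe f ≠ 0 := by
  rw [graeffe_of_splits hf]
  refine mul_ne_zero (by simpa using h0) (monic_multiset_prod_of_monic _ _ fun x _ => ?_).ne_zero
  exact monic_X_sub_C x

end Splits

/-- `q` is a nonzero polynomial whose complex roots are the `M`-th powers of the complex roots
of `p`, with multiplicities. -/
structure HasPowRoots (p : ℝ[X]) (M : ℕ) (q : ℝ[X]) : Prop where
  ne_zero : q ≠ 0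
  aroots_eq : q.aroots ℂ = (p.aroots ℂ).map (· ^ M)

namespace HasPowRoots

variable {p q : ℝ[X]} {M : ℕ}

theorem refl (hp : p ≠ 0) : HasPowRoots p 1 p :=
  ⟨hp, by simp⟩

theorem natDegree_eq (h : HasPowRoots p M q) : q.natDegree = p.natDegree := by
  have hcard := congrArg Multiset.card h.aroots_eq
  simpa only [aroots, Multiset.card_map, IsAlgClosed.card_roots_eq_natDegree,
    natDegree_map] using hcard

theorem C_mul (h : HasPowRoots p M q) {K : ℝ} (hK : K ≠ 0) : HasPowRoots p M (C K * q) :=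
  ⟨mul_ne_zero (C_ne_zero.2 hK) h.ne_zero, by rw [aroots_C_mul _ hK, h.aroots_eq]⟩

theorem graeffe (h : HasPowRoots p M q) : HasPowRoots p (2 * M) (graeffe q) where
  ne_zero := by
    refine (Polynomial.map_ne_zero_iff (algebraMap ℝ ℂ).injective).1 ?_
    rw [map_graeffe]
    refine graeffe_ne_zero (IsAlgClosed.splits _) ?_
    exact (Polynomial.map_ne_zero_iff (algebraMap ℝ ℂ).injective).2 h.ne_zero
  aroots_eq := by
    rw [aroots, map_graeffe, roots_graeffe (IsAlgClosed.splits _), ← aroots, h.aroots_eq,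
      Multiset.map_map]
    exact Multiset.map_congr rfl fun x _ => by simp only [Function.comp_apply]; ring

end HasPowRoots

/-! ### Coefficients and root radii -/

theorem mahlerMeasure_comp_C_mul_X (q : ℂ[X]) {t : ℝ} (ht : 0 < t) :
    (q.comp (C (t : ℂ) * X)).mahlerMeasure =
      ‖q.leadingCoeff‖ * (q.roots.map fun x => max t ‖x‖).prod := by
  have ht' : (t : ℂ) ≠ 0 := Complex.ofReal_ne_zero.2 ht.ne'
  conv_lhs => rw [(IsAlgClosed.splits q).eq_prod_roots]
  rw [mul_comp, multiset_prod_comp, C_comp, mahlerMeasure_mul, mahlerMeasure_const,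
    prod_mahlerMeasure_eq_mahlerMeasure_prod, Multiset.map_map, Multiset.map_map]
  refine congrArg _ (congrArg _ (Multiset.map_congr rfl fun x _ => ?_))
  have hlin : (X - C x : ℂ[X]).comp (C (t : ℂ) * X) = C (t : ℂ) * X + C (-x) := by
    rw [sub_comp, X_comp, C_comp, C_neg, sub_eq_add_neg]
  rw [Function.comp_apply, Function.comp_apply, hlin, mahlerMeasure_C_mul_X_add_C ht', norm_neg,
    Complex.norm_real, Real.norm_of_nonneg ht.le]

section Scaling

variable (q : ℂ[X]) {t : ℝ}

theorem natDegree_comp_C_mul_X (ht : 0 < t) :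
    (q.comp (C (t : ℂ) * X)).natDegree = q.natDegree := by
  rw [natDegree_comp, natDegree_C_mul_X _ (Complex.ofReal_ne_zero.2 ht.ne'), mul_one]

theorem norm_coeff_comp_C_mul_X (ht : 0 < t) (i : ℕ) :
    ‖(q.comp (C (t : ℂ) * X)).coeff i‖ = ‖q.coeff i‖ * t ^ i := by
  rw [comp_C_mul_X_coeff, norm_mul, norm_pow, Complex.norm_real, Real.norm_of_nonneg ht.le]

theorem norm_coeff_mul_pow_le (ht : 0 < t) (i : ℕ) :
    ‖q.coeff i‖ * t ^ i ≤ 2 ^ q.natDegree *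
      (‖q.leadingCoeff‖ * (q.roots.map fun x => max t ‖x‖).prod) := by
  rw [← norm_coeff_comp_C_mul_X q ht, ← mahlerMeasure_comp_C_mul_X q ht]
  refine (norm_coeff_le_choose_mul_mahlerMeasure i _).trans ?_
  rw [natDegree_comp_C_mul_X q ht]
  refine mul_le_mul_of_nonneg_right ?_ (mahlerMeasure_nonneg _)
  exact_mod_cast Nat.choose_le_two_pow _ _

theorem leadingCoeff_mul_prod_max_le (ht : 0 < t) {B : ℝ}
    (hB : ∀ i, ‖q.coeff i‖ * t ^ i ≤ B) :
    ‖q.leadingCoeff‖ * (q.roots.map fun x => max t ‖x‖).prod ≤ 2 ^ q.natDegree * B := by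
  have hB0 : 0 ≤ B := le_trans (by positivity) (hB 0)
  rw [← mahlerMeasure_comp_C_mul_X q ht]
  refine (mahlerMeasure_le_sum_norm_coeff _).trans ?_
  rw [sum_over_range _ (fun _ => norm_zero), natDegree_comp_C_mul_X q ht]
  calc ∑ i ∈ Finset.range (q.natDegree + 1), ‖(q.comp (C (t : ℂ) * X)).coeff i‖
      ≤ ∑ _i ∈ Finset.range (q.natDegree + 1), B :=
        Finset.sum_le_sum fun i _ => (norm_coeff_comp_C_mul_X q ht i).trans_le (hB i)
    _ = ((q.natDegree + 1 : ℕ) : ℝ) * B := by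
        rw [Finset.sum_const, Finset.card_range, nsmul_eq_mul]
    _ ≤ 2 ^ q.natDegree * B :=
        mul_le_mul_of_nonneg_right (by exact_mod_cast Nat.lt_two_pow_self) hB0

end Scaling

section ProdMax

variable {n : ℕ} {f : Fin n → ℝ} {r t : ℝ}

theorem prod_max_pos (ht : 0 < t) (f : Fin n → ℝ) : 0 < ∏ i, max t (f i) :=
  Finset.prod_pos fun _ _ => ht.trans_le (le_max_left _ _)

theorem prod_max_le_pow_mul (ht : 0 < t) (htr : t ≤ r) (hf : Antitone f) (j : Fin n)
    (hj : r ≤ f j) :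
    ∏ i, max r (f i) ≤ (r / t) ^ (n - 1 - (j : ℕ)) * ∏ i, max t (f i) := by
  have hpow : (r / t) ^ (n - 1 - (j : ℕ)) = ∏ i : Fin n, if j < i then r / t else 1 := by
    rw [Finset.prod_ite, Finset.prod_const, Finset.prod_const_one, mul_one,
      Finset.filter_lt_eq_Ioi, Fin.card_Ioi]
  rw [hpow, ← Finset.prod_mul_distrib]
  refine Finset.prod_le_prod (fun i _ => (ht.le.trans htr).trans (le_max_left _ _)) fun i _ => ?_
  split_ifs with hij
  · have hone : 1 ≤ r / t := (one_le_div ht).2 htr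
    refine max_le ?_ ?_
    · calc r = r / t * t := (div_mul_cancel₀ r ht.ne').symm
        _ ≤ r / t * max t (f i) := by gcongr; exact le_max_left _ _
    · calc f i ≤ max t (f i) := le_max_right _ _
        _ ≤ _ := le_mul_of_one_le_left (ht.le.trans (le_max_left _ _)) hone
  · rw [one_mul]
    exact max_le ((hj.trans (hf (not_lt.1 hij))).trans (le_max_right _ _)) (le_max_right _ _)

theorem pow_mul_prod_max_le (hr : 0 < r) (hrt : r ≤ t) (hf : Antitone f) (j : Fin n)
    (hj : f j ≤ r) :
    (t / r) ^ (n - (j : ℕ)) * ∏ i, max r (f i) ≤ ∏ i, max t (f i) := by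
  have hpow : (t / r) ^ (n - (j : ℕ)) = ∏ i : Fin n, if j ≤ i then t / r else 1 := by
    rw [Finset.prod_ite, Finset.prod_const, Finset.prod_const_one, mul_one,
      Finset.filter_le_eq_Ici, Fin.card_Ici]
  have ht : 0 < t := hr.trans_le hrt
  rw [hpow, ← Finset.prod_mul_distrib]
  refine Finset.prod_le_prod (fun i _ => ?_) fun i _ => ?_
  · have : 0 ≤ max r (f i) := hr.le.trans (le_max_left _ _)
    split_ifs <;> positivity
  · split_ifs with hij
    · rw [max_eq_left ((hf hij).trans hj), div_mul_cancel₀ t hr.ne']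
      exact le_max_left _ _
    · rw [one_mul]
      exact max_le_max_right _ hrt

end ProdMax

theorem le_of_pow_le_mul_pow {x K : ℝ} (hx : 1 ≤ x) {k l : ℕ} (hkl : k < l)
    (h : x ^ l ≤ K * x ^ k) : x ≤ K := by
  have hsub : x ^ (l - k) ≤ K := by
    rw [← Nat.sub_add_cancel hkl.le, pow_add] at h
    exact le_of_mul_le_mul_right h (by positivity)
  exact (le_self_pow₀ hx (by omega)).trans hsub

/-- The weights `a` resemble the polynomial with leading coefficient of absolute value `A` and
root radii `f`: for every `t > 0`, the largest `a i * t ^ i` agrees with `A * ∏ i, max t (f i)` up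
to a factor `C` in either direction. -/
structure TropicallyClose {n : ℕ} (C A : ℝ) (f : Fin n → ℝ) (a : ℕ → ℝ) : Prop where
  one_le : 1 ≤ C
  pos : 0 < A
  antitone : Antitone f
  term_le : ∀ t, 0 < t → ∀ i, a i * t ^ i ≤ C * (A * ∏ i, max t (f i))
  le_bound : ∀ t, 0 < t → ∀ B, (∀ i, a i * t ^ i ≤ B) → A * ∏ i, max t (f i) ≤ C * B

namespace TropicallyClose

variable {n : ℕ} {C A t : ℝ} {f : Fin n → ℝ} {a : ℕ → ℝ}

theorem term_pos_of_max (h : TropicallyClose C A f a) (ht : 0 < t) {V : ℕ}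
    (hmax : ∀ i, a i * t ^ i ≤ a V * t ^ V) : 0 < a V * t ^ V :=
  pos_of_mul_pos_right ((mul_pos h.pos (prod_max_pos ht f)).trans_le (h.le_bound t ht _ hmax))
    (zero_le_one.trans h.one_le)

theorem le_of_vertex (h : TropicallyClose C A f a) (j : Fin n) (ht : 0 < t) {V : ℕ}
    (hV : n - (j : ℕ) ≤ V) (hmax : ∀ i, a i * t ^ i ≤ a V * t ^ V) : f j ≤ C ^ 2 * t := by
  rcases le_or_gt (f j) t with hle | hlt
  · exact hle.trans (le_mul_of_one_le_left ht.le (one_le_pow₀ h.one_le))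
  have hC : 0 < C := one_pos.trans_le h.one_le
  have hA : 0 < A := h.pos
  have hterm : 0 < a V * t ^ V := h.term_pos_of_max ht hmax
  rw [← div_le_iff₀ ht]
  refine le_of_pow_le_mul_pow ((one_le_div ht).2 hlt.le) (show n - 1 - (j : ℕ) < V by omega)
    (le_of_mul_le_mul_right ?_ hterm)
  calc (f j / t) ^ V * (a V * t ^ V) = a V * f j ^ V := by rw [div_pow]; field_simp
    _ ≤ C * (A * ∏ i, max (f j) (f i)) := h.term_le _ (ht.trans hlt) V
    _ ≤ C * (A * ((f j / t) ^ (n - 1 - (j : ℕ)) * ∏ i, max t (f i))) := by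
        gcongr; exact prod_max_le_pow_mul ht hlt.le h.antitone j le_rfl
    _ = C * (f j / t) ^ (n - 1 - (j : ℕ)) * (A * ∏ i, max t (f i)) := by ring
    _ ≤ C * (f j / t) ^ (n - 1 - (j : ℕ)) * (C * (a V * t ^ V)) := by
        have : 0 < f j := ht.trans hlt
        exact mul_le_mul_of_nonneg_left (h.le_bound t ht _ hmax) (by positivity)
    _ = C ^ 2 * (f j / t) ^ (n - 1 - (j : ℕ)) * (a V * t ^ V) := by ring

theorem le_mul_of_vertex (h : TropicallyClose C A f a) (j : Fin n) (ht : 0 < t) {U : ℕ}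
    (hU : U < n - (j : ℕ)) (hmax : ∀ i, a i * t ^ i ≤ a U * t ^ U) {r : ℝ} (hr : 0 < r)
    (hjr : f j ≤ r) : t ≤ C ^ 2 * r := by
  rcases le_or_gt t r with hle | hlt
  · exact hle.trans (le_mul_of_one_le_left hr.le (one_le_pow₀ h.one_le))
  have hC : 0 < C := one_pos.trans_le h.one_le
  have hA : 0 < A := h.pos
  rw [← div_le_iff₀ hr]
  refine le_of_pow_le_mul_pow ((one_le_div hr).2 hlt.le) hU
    (le_of_mul_le_mul_right ?_ (mul_pos hA (prod_max_pos hr f)))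
  calc (t / r) ^ (n - (j : ℕ)) * (A * ∏ i, max r (f i))
      = A * ((t / r) ^ (n - (j : ℕ)) * ∏ i, max r (f i)) := by ring
    _ ≤ A * ∏ i, max t (f i) := by
        gcongr; exact pow_mul_prod_max_le hr hlt.le h.antitone j hjr
    _ ≤ C * (a U * t ^ U) := h.le_bound t ht _ hmax
    _ = C * ((t / r) ^ U * (a U * r ^ U)) := by rw [div_pow]; field_simp
    _ ≤ C * ((t / r) ^ U * (C * (A * ∏ i, max r (f i)))) := by
        have := h.term_le r hr U
        gcongr C * ((t / r) ^ U * ?_)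
    _ = C ^ 2 * (t / r) ^ U * (A * ∏ i, max r (f i)) := by ring

theorem ge_of_vertex (h : TropicallyClose C A f a) (j : Fin n) (ht : 0 < t) {U : ℕ}
    (hU : U < n - (j : ℕ)) (hmax : ∀ i, a i * t ^ i ≤ a U * t ^ U) : t ≤ C ^ 2 * f j := by
  have hC : 0 < C ^ 2 := pow_pos (one_pos.trans_le h.one_le) 2
  by_contra! hlt
  obtain ⟨r, hr, hrt⟩ := exists_between (max_lt ((lt_div_iff₀' hC).2 hlt) (div_pos ht hC))
  have hle : t ≤ C ^ 2 * r :=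
    h.le_mul_of_vertex j ht hU hmax ((le_max_right _ _).trans_lt hr) ((le_max_left _ _).trans hr.le)
  exact ((lt_div_iff₀' hC).1 hrt).not_ge hle

theorem nonpos_of_forall_lt_eq_zero (h : TropicallyClose C A f a) (hnn : ∀ i, 0 ≤ a i)
    (hbig : ∀ i, n < i → a i = 0) (j : Fin n) (hsmall : ∀ i < n - (j : ℕ), a i = 0) :
    f j ≤ 0 := by
  have hC : 0 < C ^ 2 := pow_pos (one_pos.trans_le h.one_le) 2
  have hscale : ∀ t, 0 < t → f j ≤ C ^ 2 * t := by
    intro t ht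
    obtain ⟨k, -, hk⟩ := Finset.exists_max_image (Finset.range (n + 1)) (fun i => a i * t ^ i)
      Finset.nonempty_range_add_one
    have hmax : ∀ i, a i * t ^ i ≤ a k * t ^ k := by
      intro i
      rcases lt_or_ge n i with hi | hi
      · rw [hbig i hi, zero_mul]
        exact mul_nonneg (hnn k) (pow_nonneg ht.le k)
      · exact hk i (Finset.mem_range_succ_iff.2 hi)
    refine h.le_of_vertex j ht (le_of_not_gt fun hkj => ?_) hmax
    have := h.term_pos_of_max ht hmax
    rw [hsmall k hkj, zero_mul] at this
    exact lt_irrefl _ this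
  by_contra! hpos
  have := hscale (f j / (2 * C ^ 2)) (by positivity)
  have hhalf : C ^ 2 * (f j / (2 * C ^ 2)) = f j / 2 := by
    rw [← div_div, mul_div_cancel₀ _ hC.ne']
  linarith

end TropicallyClose

theorem rootRadius_antitone (p : ℝ[X]) : Antitone (rootRadius p) := fun _ _ hij =>
  (List.sortedGE_iff_pairwise.2 (Multiset.pairwise_sort _ (· ≥ ·))).antitone_get hij

theorem rootRadius_nonneg (p : ℝ[X]) (j : Fin p.natDegree) : 0 ≤ rootRadius p j := by
  have hmem : rootRadius p j ∈ rootRadii p := List.get_mem _ _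
  rw [rootRadii, Multiset.mem_sort, Multiset.mem_map] at hmem
  obtain ⟨x, -, hx⟩ := hmem
  exact hx ▸ norm_nonneg x

theorem prod_rootRadius (p : ℝ[X]) (g : ℝ → ℝ) :
    ∏ j, g (rootRadius p j) = ((p.aroots ℂ).map fun x => g ‖x‖).prod := by
  have hcoe :
      (p.aroots ℂ).map (fun x => g ‖x‖) = (((rootRadii p).map g : List ℝ) : Multiset ℝ) := by
    rw [← Multiset.map_coe, rootRadii, Multiset.sort_eq, Multiset.map_map]
    rfl
  rw [hcoe, Multiset.prod_coe, ← Fin.prod_univ_getElem]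
  refine Fintype.prod_equiv (finCongr ?_) _ _ fun j => ?_
  · rw [List.length_map, length_rootRadii]
  · simp only [rootRadius, List.get_eq_getElem, Fin.val_cast, finCongr_apply, List.getElem_map]

theorem HasPowRoots.tropicallyClose {p q : ℝ[X]} {M : ℕ} (h : HasPowRoots p M q) :
    TropicallyClose (2 ^ p.natDegree) |q.leadingCoeff| (fun j => rootRadius p j ^ M)
      fun i => |q.coeff i| := by
  have hprod (t : ℝ) : ((q.aroots ℂ).map fun x => max t ‖x‖).prod =
      ∏ j, max t (rootRadius p j ^ M) := by
    rw [prod_rootRadius p fun x => max t (x ^ M), h.aroots_eq, Multiset.map_map]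
    simp only [Function.comp_apply, norm_pow]
  have hnorm (i : ℕ) : ‖(q.map (algebraMap ℝ ℂ)).coeff i‖ = |q.coeff i| := by
    rw [coeff_map, norm_algebraMap', Real.norm_eq_abs]
  have hlead : ‖(q.map (algebraMap ℝ ℂ)).leadingCoeff‖ = |q.leadingCoeff| := by
    rw [leadingCoeff_map, norm_algebraMap', Real.norm_eq_abs]
  have hdeg : (q.map (algebraMap ℝ ℂ)).natDegree = p.natDegree := by
    rw [natDegree_map, h.natDegree_eq]
  refine ⟨one_le_pow₀ one_le_two, abs_pos.2 (leadingCoeff_ne_zero.2 h.ne_zero), ?_, ?_, ?_⟩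
  · exact fun i j hij => pow_le_pow_left₀ (rootRadius_nonneg p j) (rootRadius_antitone p hij) _
  · intro t ht i
    simpa only [hnorm, hlead, hdeg, hprod] using norm_coeff_mul_pow_le (q.map (algebraMap ℝ ℂ)) ht i
  · intro t ht B hB
    simpa only [hlead, hdeg, hprod] using
      leadingCoeff_mul_prod_max_le (q.map (algebraMap ℝ ℂ)) ht (by simpa only [hnorm] using hB)

/-! ### The discrete Fourier transform -/

theorem sum_range_two_mul {M : Type*} [AddCommMonoid M] (f : ℕ → M) (q : ℕ) :
    ∑ i ∈ Finset.range (2 * q), f i =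
      ∑ i ∈ Finset.range q, f (2 * i) + ∑ i ∈ Finset.range q, f (2 * i + 1) := by
  induction q with
  | zero => simp only [mul_zero, Finset.range_zero, Finset.sum_empty, add_zero]
  | succ q ih =>
    simp only [Nat.mul_succ, Finset.sum_range_succ, ih]
    abel

theorem geom_sum_eq_zero_of_pow_eq_one {R : Type*} [CommRing R] [IsDomain R] {x : R} {n : ℕ}
    (hx : x ≠ 1) (hn : x ^ n = 1) : ∑ i ∈ Finset.range n, x ^ i = 0 := by
  have h := mul_geom_sum x n
  rw [hn, sub_self] at h
  exact (mul_eq_zero.1 h).resolve_left (sub_ne_zero.2 hx)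

theorem isPrimitiveRoot_of_pow_eq_neg_one {R : Type*} [CommRing R] [NeZero (2 : R)] {ω : R}
    {l : ℕ} (h : ω ^ 2 ^ l = -1) :
    IsPrimitiveRoot ω (2 ^ (l + 1)) := by
  have horder : orderOf ω = 2 ^ (l + 1) := by
    refine orderOf_eq_prime_pow ?_ ?_
    · rw [h, neg_eq_iff_add_eq_zero, one_add_one_eq_two]
      exact two_ne_zero
    · rw [pow_succ, pow_mul, h, neg_one_sq]
  exact horder ▸ IsPrimitiveRoot.orderOf ω

/-- The discrete Fourier transform of length `N` with respect to `ω`. -/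
def dft {R : Type*} [CommSemiring R] (N : ℕ) (ω : R) (a : ℕ → R) (x : ℕ) : R :=
  ∑ i ∈ Finset.range N, a i * ω ^ (i * x)

theorem dft_congr {R : Type*} [CommSemiring R] {N : ℕ} {ω : R} {a b : ℕ → R}
    (h : ∀ i < N, a i = b i) (x : ℕ) : dft N ω a x = dft N ω b x :=
  Finset.sum_congr rfl fun i hi => by rw [h i (Finset.mem_range.1 hi)]

theorem dft_coeff {R : Type*} [CommSemiring R] {N : ℕ} (ω : R) {f : R[X]}
    (hf : f.natDegree < N) (x : ℕ) : dft N ω f.coeff x = f.eval (ω ^ x) := by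
  rw [dft, eval_eq_sum_range' hf]
  refine Finset.sum_congr rfl fun i _ => ?_
  rw [← pow_mul, mul_comm x]

section Inversion

variable {R : Type*} [CommRing R] [IsDomain R] {N : ℕ} {ω : R}

theorem sum_pow_mul_pow_sub (hω : IsPrimitiveRoot ω N) {k m : ℕ} (hk : k < N) (hm : m < N) :
    ∑ x ∈ Finset.range N, ω ^ (k * x) * ω ^ (x * ((N - m) % N)) = if k = m then (N : R) else 0 := by
  have hterm (x : ℕ) : ω ^ (k * x) * ω ^ (x * ((N - m) % N)) = (ω ^ (k + (N - m))) ^ x := by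
    rw [mul_comm x, pow_mul _ ((N - m) % N), ← pow_eq_pow_mod _ hω.pow_eq_one, ← pow_mul,
      ← pow_add, ← add_mul, pow_mul]
  simp_rw [hterm]
  split_ifs with hkm
  · rw [hkm, Nat.add_sub_cancel' hm.le, hω.pow_eq_one]
    simp only [one_pow, Finset.sum_const, Finset.card_range, nsmul_eq_mul, mul_one]
  · refine geom_sum_eq_zero_of_pow_eq_one ?_ ?_
    · rw [Ne, hω.pow_eq_one_iff_dvd]
      rintro ⟨c, hc⟩
      rcases Nat.lt_or_ge c 2 with h | h
      · interval_cases c <;> omega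
      · have := Nat.mul_le_mul_left N h
        omega
    · rw [← pow_mul, mul_comm, pow_mul, hω.pow_eq_one, one_pow]

theorem dft_dft (hω : IsPrimitiveRoot ω N) (a : ℕ → R) {m : ℕ} (hm : m < N) :
    dft N ω (dft N ω a) ((N - m) % N) = N * a m := by
  simp only [dft, Finset.sum_mul]
  rw [Finset.sum_comm]
  calc ∑ k ∈ Finset.range N, ∑ x ∈ Finset.range N, a k * ω ^ (k * x) * ω ^ (x * ((N - m) % N))
      = ∑ k ∈ Finset.range N, if k = m then (N : R) * a m else 0 := by
        refine Finset.sum_congr rfl fun k hk => ?_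
        simp only [mul_assoc]
        rw [← Finset.mul_sum, sum_pow_mul_pow_sub hω (Finset.mem_range.1 hk) hm, mul_ite, mul_zero]
        split_ifs with hkm
        · rw [hkm, mul_comm]
        · rfl
    _ = N * a m := by
        rw [Finset.sum_ite_eq' _ _ (fun _ => (N : R) * a m), if_pos (Finset.mem_range.2 hm)]

-- Since `-ω ^ x = ω ^ (x + 2 ^ l)`, the shifted transform is that of `f.comp (-X)`.
theorem dft_mul_dft_shift [NeZero (2 : R)] {l : ℕ} (hω : ω ^ 2 ^ l = -1) {f : R[X]}
    (hf : 2 * f.natDegree < 2 ^ (l + 1)) {i : ℕ} (hi : 2 * i < 2 ^ (l + 1)) :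
    dft (2 ^ (l + 1)) ω (fun x => dft (2 ^ (l + 1)) ω f.coeff x *
        dft (2 ^ (l + 1)) ω f.coeff ((x + 2 ^ l) % 2 ^ (l + 1)))
      ((2 ^ (l + 1) - 2 * i) % 2 ^ (l + 1)) = (2 ^ (l + 1) : ℕ) * (graeffe f).coeff i := by
  have hprim := isPrimitiveRoot_of_pow_eq_neg_one hω
  have hdeg : (f * f.comp (-X)).natDegree < 2 ^ (l + 1) := by
    refine natDegree_mul_le.trans_lt ?_
    rw [natDegree_comp, natDegree_neg, natDegree_X]
    omega
  rw [coeff_graeffe, ← dft_dft hprim _ hi]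
  refine dft_congr (fun x _ => ?_) _
  rw [dft_coeff _ (by omega), dft_coeff _ (by omega), dft_coeff _ hdeg, eval_mul, eval_comp,
    ← pow_eq_pow_mod _ hprim.pow_eq_one, pow_add, hω, mul_neg_one, eval_neg, eval_X]

end Inversion

/-- The array after the stage of the fast Fourier transform in which transforms of the `h`
arithmetic progressions of step `h` have been computed; the transform of the progression that
starts at `b < h` occupies the positions congruent to `b` modulo `h`. -/
def stridedDFT {R : Type*} [CommSemiring R] (N h : ℕ) (ω : R) (a : ℕ → R) (x : ℕ) : R :=
  ∑ i ∈ Finset.range (N / h), a (x % h + i * h) * ω ^ (i * (x - x % h))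

/-- The first of the two entries at stride `2 * h` from which entry `x` at stride `h` is computed;
the second one comes `h` later. -/
def butterflyIndex (N h x : ℕ) : ℕ := 2 * (x - x % h) % N + x % h

theorem sub_mod_eq_mul_div (x h : ℕ) : x - x % h = h * (x / h) := by
  have := Nat.mod_add_div x h
  omega

theorem butterflyIndex_eq (h q x : ℕ) :
    butterflyIndex (2 * h * q) h x = 2 * h * (x / h % q) + x % h := by
  rw [butterflyIndex, sub_mod_eq_mul_div, ← mul_assoc, Nat.mul_mod_mul_left]

theorem butterflyIndex_add_lt {N h x : ℕ} (hN : 2 * h ∣ N) (hx : x < N) (hh : 0 < h) :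
    butterflyIndex N h x + h < N := by
  obtain ⟨q, rfl⟩ := hN
  have hq : 0 < q := Nat.pos_of_ne_zero (by rintro rfl; simp at hx)
  have hmul := Nat.mul_le_mul_left (2 * h) (show x / h % q + 1 ≤ q from Nat.mod_lt _ hq)
  have hmod := Nat.mod_lt x hh
  rw [mul_add] at hmul
  rw [butterflyIndex_eq]
  omega

section Stages

variable {R : Type*} [CommSemiring R]

theorem stridedDFT_self {N : ℕ} (ω : R) (a : ℕ → R) {x : ℕ} (hx : x < N) :
    stridedDFT N N ω a x = a x := by
  rw [stridedDFT, Nat.div_self (Nat.zero_lt_of_lt hx), Finset.sum_range_one, Nat.mod_eq_of_lt hx,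
    zero_mul, zero_mul, add_zero, pow_zero, mul_one]

theorem stridedDFT_one (N : ℕ) (ω : R) (a : ℕ → R) (x : ℕ) :
    stridedDFT N 1 ω a x = dft N ω a x := by
  simp only [stridedDFT, dft, Nat.mod_one, Nat.div_one, zero_add, mul_one, Nat.sub_zero]

theorem stridedDFT_halve {N h : ℕ} (hh : 0 < h) (hN : 2 * h ∣ N) {ω : R} (hω : ω ^ N = 1)
    (a : ℕ → R) (x : ℕ) :
    stridedDFT N h ω a x = stridedDFT N (2 * h) ω a (butterflyIndex N h x) +
      ω ^ (x - x % h) * stridedDFT N (2 * h) ω a (butterflyIndex N h x + h) := by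
  obtain ⟨q, rfl⟩ := hN
  have hb : x % h < h := Nat.mod_lt x hh
  have mod_fst : (2 * h * (x / h % q) + x % h) % (2 * h) = x % h := by
    rw [Nat.mul_add_mod, Nat.mod_eq_of_lt (by omega)]
  have mod_snd : (2 * h * (x / h % q) + x % h + h) % (2 * h) = x % h + h := by
    rw [add_assoc, Nat.mul_add_mod, Nat.mod_eq_of_lt (by omega)]
  have div_fst : 2 * h * q / h = 2 * q := by
    rw [mul_comm 2 h, mul_assoc, Nat.mul_div_cancel_left _ hh]
  have div_snd : 2 * h * q / (2 * h) = q := Nat.mul_div_cancel_left _ (by omega)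
  have pow_reduce (i : ℕ) :
      ω ^ (i * (2 * h * (x / h % q))) = ω ^ (i * (2 * (h * (x / h)))) := by
    rw [← Nat.mul_mod_mul_left, mul_comm i, mul_comm i, pow_mul _ _ i, pow_mul _ _ i,
      ← pow_eq_pow_mod _ hω, mul_assoc 2 h]
  rw [stridedDFT, stridedDFT, stridedDFT, butterflyIndex_eq, mod_fst, mod_snd, div_fst, div_snd,
    sum_range_two_mul, sub_mod_eq_mul_div, add_assoc, Nat.add_sub_cancel, Nat.add_sub_cancel,
    Finset.mul_sum]
  refine congrArg₂ (· + ·) (Finset.sum_congr rfl fun i _ => ?_) (Finset.sum_congr rfl fun i _ => ?_)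
  · rw [pow_reduce]
    congr 2 <;> ring
  · rw [pow_reduce, mul_left_comm (ω ^ (h * (x / h))), ← pow_add]
    congr 2 <;> ring

end Stages

local infixr:60 " ;; " => RealRAM.Prog.seq

namespace RealRAM

/-! ### Hoare triples with costs -/

/-- Hoare triple with a cost: started in `s`, the program `P` executes at most `C` instructions and
ends in a state with the property `Q`. -/
def Prog.Meets (P : Prog) (s : State) (C : ℕ) (Q : State → Prop) : Prop :=
  P.cost s ≤ C ∧ Q (P.run s)

theorem Prog.Meets.mono {P : Prog} {s : State} {C C' : ℕ} {Q Q' : State → Prop}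
    (h : P.Meets s C Q) (hC : C ≤ C') (hQ : ∀ s', Q s' → Q' s') : P.Meets s C' Q' :=
  ⟨h.1.trans hC, hQ _ h.2⟩

theorem Prog.Meets.seq {P P' : Prog} {s : State} {C C' : ℕ} {Q Q' : State → Prop}
    (h : P.Meets s C Q) (h' : ∀ s', Q s' → P'.Meets s' C' Q') : (P ;; P').Meets s (C + C') Q' :=
  ⟨Nat.add_le_add h.1 (h' _ h.2).1, (h' _ h.2).2⟩

theorem Prog.Meets.setNat_seq {P : Prog} {s : State} {C : ℕ} {Q : State → Prop} {a e : NatExpr}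
    (h : P.Meets (s.storeNat (a.eval s) (e.eval s)) C Q) : (.setNat a e ;; P).Meets s (1 + C) Q :=
  ⟨Nat.add_le_add_left h.1 1, h.2⟩

theorem Prog.Meets.setReal_seq {P : Prog} {s : State} {C : ℕ} {Q : State → Prop} {a e : NatExpr}
    (h : P.Meets (s.storeReal (a.eval s) (e.eval s)) C Q) :
    (.setReal a e ;; P).Meets s (1 + C) Q :=
  ⟨Nat.add_le_add_left h.1 1, h.2⟩

theorem Prog.Meets.ifNat {a b : NatExpr} {P P' : Prog} {s : State} {C : ℕ} {Q : State → Prop}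
    (h : a.eval s ≤ b.eval s → P.Meets s C Q) (h' : b.eval s < a.eval s → P'.Meets s C Q) :
    (Prog.ifNat a b P P').Meets s (1 + C) Q := by
  rw [Prog.Meets, Prog.cost, Prog.run]
  split_ifs with hab
  · exact ⟨Nat.add_le_add_left (h hab).1 1, (h hab).2⟩
  · exact ⟨Nat.add_le_add_left (h' (not_le.1 hab)).1 1, (h' (not_le.1 hab)).2⟩

theorem Prog.Meets.ifReal {a b : NatExpr} {P P' : Prog} {s : State} {C : ℕ} {Q : State → Prop}
    (h : s.reals (a.eval s) ≤ s.reals (b.eval s) → P.Meets s C Q)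
    (h' : s.reals (b.eval s) < s.reals (a.eval s) → P'.Meets s C Q) :
    (Prog.ifReal a b P P').Meets s (1 + C) Q := by
  rw [Prog.Meets, Prog.cost, Prog.run]
  split_ifs with hab
  · exact ⟨Nat.add_le_add_left (h hab).1 1, (h hab).2⟩
  · exact ⟨Nat.add_le_add_left (h' (not_le.1 hab)).1 1, (h' (not_le.1 hab)).2⟩

theorem Prog.Meets.loop {P : Prog} {s : State} {e : NatExpr} {m C : ℕ} (I : ℕ → State → Prop)
    (he : e.eval s = m) (h0 : I 0 s) (hstep : ∀ i < m, ∀ s', I i s' → P.Meets s' C (I (i + 1))) :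
    (Prog.loop e P).Meets s (1 + m * (1 + C)) (I m) := by
  have hI : ∀ i ≤ m, I i (P.run^[i] s) := by
    intro i
    induction i with
    | zero => exact fun _ => h0
    | succ i ih =>
      intro hi
      rw [Function.iterate_succ_apply']
      exact (hstep i hi _ (ih (by omega))).2
  refine ⟨?_, ?_⟩
  · rw [Prog.cost, he]
    gcongr
    calc _ ≤ ∑ _i ∈ Finset.range m, (1 + C) := by
          refine Finset.sum_le_sum fun i hi => ?_
          have hi := Finset.mem_range.1 hi
          exact Nat.add_le_add_left (hstep i hi _ (hI i hi.le)).1 1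
      _ = m * (1 + C) := by simp
  · rw [Prog.run, he]
    exact hI m le_rfl

theorem State.storeNat_nats (s : State) (i v : ℕ) :
    (s.storeNat i v).nats = Function.update s.nats i v := rfl

theorem State.storeNat_reals (s : State) (i v : ℕ) : (s.storeNat i v).reals = s.reals := rfl

theorem State.storeReal_nats (s : State) (i : ℕ) (v : ℝ) : (s.storeReal i v).nats = s.nats := rfl

theorem State.storeReal_reals (s : State) (i : ℕ) (v : ℝ) :
    (s.storeReal i v).reals = Function.update s.reals i v := rfl

theorem NatExpr.eval_congr {s s' : State} (h : s'.nats = s.nats) (e : NatExpr) :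
    e.eval s' = e.eval s := by
  induction e with
  | lit k => rfl
  | load a ih => simp only [NatExpr.eval, ih, h]
  | _ a b iha ihb => simp only [NatExpr.eval, iha, ihb]

theorem NatExpr.eval_storeReal (s : State) (i : ℕ) (v : ℝ) (e : NatExpr) :
    e.eval (s.storeReal i v) = e.eval s :=
  NatExpr.eval_congr (State.storeReal_nats s i v) e

/-- The content of the natural number cell `k`.  The cells `0, …, 7` hold the degree of the input,
the length `N` of the arrays, `log₂ N`, the power to which the roots have been raised, the loop
counter, the stride of the Fourier transform or the size of the stack, and two scratch values. -/
abbrev NatExpr.cell (k : ℕ) : NatExpr := .load (.lit k)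

/-- Execute `P` for the values `0, 1, …, e - 1` of the loop counter. -/
def Prog.forUpTo (e : NatExpr) (P : Prog) : Prog :=
  .setNat (.lit 4) (.lit 0) ;; .loop e (P ;; .setNat (.lit 4) (.add (.cell 4) (.lit 1)))

theorem Prog.Meets.forUpTo {P : Prog} {s : State} {e : NatExpr} {m C : ℕ} (I : ℕ → State → Prop)
    (he : e.eval (s.storeNat 4 0) = m) (h0 : I 0 (s.storeNat 4 0))
    (hstep : ∀ i < m, ∀ s', s'.nats 4 = i → I i s' →
      P.Meets s' C fun s'' => s''.nats 4 = i ∧ I (i + 1) (s''.storeNat 4 (i + 1))) :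
    (Prog.forUpTo e P).Meets s (2 + m * (2 + C)) (I m) := by
  refine (Prog.Meets.setNat_seq (C := 1 + m * (1 + (C + 1))) (Q := fun s' => s'.nats 4 = m ∧ I m s')
    ?_).mono (by ring_nf; rfl) fun _ h => h.2
  refine Prog.Meets.loop (fun i s' => s'.nats 4 = i ∧ I i s') he
    ⟨by simp [State.storeNat, NatExpr.eval], h0⟩ ?_
  rintro i hi s' ⟨h4, hI⟩
  refine (hstep i hi s' h4 hI).seq ?_
  rintro s'' ⟨h4', hI'⟩
  refine ⟨le_rfl, ?_⟩
  simp only [Prog.run, NatExpr.eval, h4']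
  exact ⟨by simp [State.storeNat], hI'⟩

/-! ### Complex arrays -/

/-- The address of entry `i` of the `k`-th array of real numbers, each array having the length in
cell `1`. -/
abbrev NatExpr.arr (k : ℕ) (i : NatExpr) : NatExpr := .add (.mul (.lit k) (.cell 1)) i

/-- Entry `i` of the complex array that consists of the `k`-th and the `k + 1`-st array of real
numbers, of length `N` each.  Array `0` holds the coefficients of a polynomial, the complex arrays
`1` and `3` data to be transformed, and the complex array `5` the powers of a root of unity, which
itself is entry `0` of the complex array `7`. -/
def State.cplx (s : State) (N k i : ℕ) : ℂ := ⟨s.reals (k * N + i), s.reals ((k + 1) * N + i)⟩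

/-- Store in entry `i` of the complex array `k` the product of entry `x` of the complex array `kx`
and entry `y` of the complex array `ky`; array `9` serves as scratch. -/
def Prog.mulEntry (k : ℕ) (i : NatExpr) (kx : ℕ) (x : NatExpr) (ky : ℕ) (y : NatExpr) : Prog :=
  .arith .mul (.arr k i) (.arr kx x) (.arr ky y) ;;
  .arith .mul (.arr 9 (.lit 0)) (.arr (kx + 1) x) (.arr (ky + 1) y) ;;
  .arith .sub (.arr k i) (.arr k i) (.arr 9 (.lit 0)) ;;
  .arith .mul (.arr (k + 1) i) (.arr kx x) (.arr (ky + 1) y) ;;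
  .arith .mul (.arr 9 (.lit 0)) (.arr (kx + 1) x) (.arr ky y) ;;
  .arith .add (.arr (k + 1) i) (.arr (k + 1) i) (.arr 9 (.lit 0))

theorem Prog.meets_mulEntry {s : State} {N k kx ky a b c : ℕ} {i x y : NatExpr}
    (hN : s.nats 1 = N) (hi : i.eval s = a) (hx : x.eval s = b) (hy : y.eval s = c)
    (hpos : 0 < N) (hk : (k + 1) * N + a < 9 * N)
    (hop : ∀ v ∈ [kx * N + b, (kx + 1) * N + b, ky * N + c, (ky + 1) * N + c],
      v ≠ k * N + a ∧ v ≠ (k + 1) * N + a ∧ v < 9 * N) :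
    (Prog.mulEntry k i kx x ky y).Meets s 6 fun s' =>
      s'.nats = s.nats ∧
      (∀ v, v ≠ k * N + a → v ≠ (k + 1) * N + a → v ≠ 9 * N → s'.reals v = s.reals v) ∧
      s'.cplx N k a = s.cplx N kx b * s.cplx N ky c := by
  simp only [List.mem_cons, List.not_mem_nil, or_false, forall_eq_or_imp, forall_eq] at hop
  rw [add_one_mul] at hk
  have hne : (k + 1) * N + a ≠ k * N + a := by rw [add_one_mul]; omega
  have hre : k * N + a ≠ 9 * N := by omega
  have him : (k + 1) * N + a ≠ 9 * N := by rw [add_one_mul]; omega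
  obtain ⟨⟨b1, -, b3⟩, ⟨b4, b5, b6⟩, ⟨c1, c2, c3⟩, c4, -, c6⟩ := hop
  refine ⟨by simp [Prog.mulEntry, Prog.cost], ?_⟩
  simp only [Prog.mulEntry, Prog.run, NatExpr.eval, NatExpr.eval_storeReal, State.storeReal_nats,
    State.storeReal_reals, ArithOp.eval, hN, hi, hx, hy, add_zero]
  refine ⟨trivial, fun v h1 h2 h3 => by simp only [ne_eq, h1, h2, h3, not_false_eq_true,
    Function.update_of_ne], ?_⟩
  apply Complex.ext <;>
    simp only [State.cplx, State.storeReal_reals, Complex.mul_re, Complex.mul_im,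
      Function.update_self, Function.update_of_ne, ne_eq, not_false_eq_true, hne.symm, hre, him, b1,
      b3.ne, b4, b5, b6.ne, c1, c2, c3.ne, c4, c6.ne]

/-- Compute the entries of the complex array `3` by `P`. -/
def Prog.fillArray (P : Prog) : Prog :=
  .forUpTo (.cell 1) P

/-- Move the complex array `3` to the complex array `1`. -/
def Prog.moveArray : Prog :=
  .forUpTo (.cell 1) <|
    .copy (.arr 1 (.cell 4)) (.arr 3 (.cell 4)) ;; .copy (.arr 2 (.cell 4)) (.arr 4 (.cell 4))

/-- Replace the entries of the complex array `1` by those that `P` computes. -/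
def Prog.mapArray (P : Prog) : Prog :=
  P.fillArray ;; .moveArray

/-- The parameters and all arrays before the array `7`, but for the arrays `3` and `4`, agree. -/
structure AgreeOffArray (N : ℕ) (s s' : State) : Prop where
  nats : ∀ k, k < 4 ∨ k = 5 → s'.nats k = s.nats k
  reals : ∀ x, x < 3 * N ∨ 5 * N ≤ x ∧ x < 7 * N → s'.reals x = s.reals x

theorem AgreeOffArray.cplx_eq {N k i : ℕ} {s s' : State} (h : AgreeOffArray N s s')
    (hk : k = 1 ∨ k = 5) (hi : i < N) : s'.cplx N k i = s.cplx N k i := by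
  rcases hk with rfl | rfl <;> rw [State.cplx, h.reals _ (by omega), h.reals _ (by omega)] <;> rfl

/-- The parameters, the array `0` and the complex array `5` agree. -/
structure Frame (N : ℕ) (s s' : State) : Prop where
  nats : ∀ k, k < 4 → s'.nats k = s.nats k
  reals : ∀ x, x < N ∨ 5 * N ≤ x ∧ x < 7 * N → s'.reals x = s.reals x

theorem Frame.refl (N : ℕ) (s : State) : Frame N s s := ⟨fun _ _ => rfl, fun _ _ => rfl⟩

theorem Frame.trans {N : ℕ} {s s' s'' : State} (h : Frame N s s') (h' : Frame N s' s'') :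
    Frame N s s'' :=
  ⟨fun k hk => (h'.nats k hk).trans (h.nats k hk), fun x hx => (h'.reals x hx).trans (h.reals x hx)⟩

theorem Frame.storeNat {N : ℕ} {s s' : State} (h : Frame N s s') {k : ℕ} (hk : 4 ≤ k) (v : ℕ) :
    Frame N s (s'.storeNat k v) := by
  refine ⟨fun j hj => ?_, fun x hx => h.reals x hx⟩
  rw [State.storeNat_nats, Function.update_of_ne (by omega), h.nats j hj]

/-- Started in `s`, the program `P` stores `z` in that entry of the complex array `3` to which the
loop counter points, and otherwise changes only scratch memory. -/
def Prog.WritesEntry (P : Prog) (s : State) (N C : ℕ) (z : ℂ) : Prop :=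
  P.Meets s C fun s' => (∀ k < 6, s'.nats k = s.nats k) ∧
    (∀ x, x ≠ 3 * N + s.nats 4 → x ≠ 4 * N + s.nats 4 → x < 7 * N → s'.reals x = s.reals x) ∧
    s'.cplx N 3 (s.nats 4) = z

theorem Prog.meets_fillArray {P : Prog} {s : State} {N C : ℕ} {F : ℕ → ℂ} (hN : s.nats 1 = N)
    (hP : ∀ i < N, ∀ s', s'.nats 4 = i → AgreeOffArray N s s' → P.WritesEntry s' N C (F i)) :
    P.fillArray.Meets s (2 + N * (2 + C)) fun s' =>
      AgreeOffArray N s s' ∧ ∀ i < N, s'.cplx N 3 i = F i := by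
  refine Prog.Meets.forUpTo
    (fun m s' => AgreeOffArray N s s' ∧ ∀ i < m, s'.cplx N 3 i = F i) ?_ ?_ ?_
  · simp [NatExpr.eval, State.storeNat, hN]
  · refine ⟨⟨fun k hk => ?_, fun x _ => rfl⟩, fun i hi => absurd hi (by omega)⟩
    rw [State.storeNat_nats, Function.update_of_ne (by omega)]
  · rintro i hi s' h4 ⟨hag, hF⟩
    refine (hP i hi s' h4 hag).mono le_rfl ?_
    rw [h4]
    rintro s'' ⟨hn, hr, hB⟩
    refine ⟨(hn 4 (by omega)).trans h4, ⟨fun k hk => ?_, fun x hx => ?_⟩, fun j hj => ?_⟩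
    · rw [State.storeNat_nats, Function.update_of_ne (by omega), hn k (by omega), hag.nats k hk]
    · rw [State.storeNat_reals, hr x (by omega) (by omega) (by omega), hag.reals x hx]
    · rcases Nat.lt_succ_iff_lt_or_eq.1 hj with hj | rfl
      · rw [← hF j hj]
        simp only [State.cplx, State.storeNat_reals]
        rw [hr _ (by omega) (by omega) (by omega), hr _ (by omega) (by omega) (by omega)]
      · exact hB

theorem Prog.meets_moveArray {s : State} {N : ℕ} (hN : s.nats 1 = N) :
    Prog.moveArray.Meets s (2 + N * 4) fun s' => (∀ k, k < 4 ∨ k = 5 → s'.nats k = s.nats k) ∧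
      (∀ x, x < N ∨ 3 * N ≤ x → s'.reals x = s.reals x) ∧
      ∀ i < N, s'.cplx N 1 i = s.cplx N 3 i := by
  refine Prog.Meets.forUpTo (C := 2) (fun m s' => (∀ k, k < 4 ∨ k = 5 → s'.nats k = s.nats k) ∧
    (∀ x, x < N ∨ 3 * N ≤ x → s'.reals x = s.reals x) ∧
    ∀ i < m, s'.cplx N 1 i = s.cplx N 3 i) ?_ ?_ ?_
  · simp [NatExpr.eval, State.storeNat, hN]
  · refine ⟨fun k hk => ?_, fun x _ => rfl, fun i hi => absurd hi (by omega)⟩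
    rw [State.storeNat_nats, Function.update_of_ne (by omega)]
  · rintro i hi s' h4 ⟨hn, hr, hA⟩
    have hN' : s'.nats 1 = N := by rw [hn 1 (by omega), hN]
    refine ⟨by simp [Prog.cost], ?_⟩
    simp only [Prog.run, NatExpr.eval, State.storeReal_nats, State.storeReal_reals, h4, hN']
    refine ⟨trivial, fun k hk => ?_, fun x hx => ?_, fun j hj => ?_⟩
    · rw [State.storeNat_nats, Function.update_of_ne (by omega)]
      exact hn k hk
    · simp only [State.storeNat_reals, State.storeReal_reals]
      rw [Function.update_of_ne (by omega), Function.update_of_ne (by omega), hr x hx]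
    · simp only [State.cplx, State.storeNat_reals, State.storeReal_reals]
      rcases Nat.lt_succ_iff_lt_or_eq.1 hj with hj | rfl
      · rw [← State.cplx, ← hA j hj]
        simp (disch := omega) only [State.cplx, Function.update_of_ne]
      · simp (disch := omega) only [Function.update_of_ne, Function.update_self]
        rw [hr _ (by omega), hr _ (by omega)]

theorem Prog.meets_mapArray {P : Prog} {s : State} {N C : ℕ} {F : ℕ → ℂ} (hN : s.nats 1 = N)
    (hP : ∀ i < N, ∀ s', s'.nats 4 = i → AgreeOffArray N s s' → P.WritesEntry s' N C (F i)) :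
    P.mapArray.Meets s (4 + N * (6 + C)) fun s' =>
      Frame N s s' ∧ s'.nats 5 = s.nats 5 ∧ ∀ i < N, s'.cplx N 1 i = F i := by
  refine ((Prog.meets_fillArray hN hP).seq (C' := 2 + N * 4) ?_).mono (by ring_nf; rfl)
    fun s' h => h
  rintro s₁ ⟨hag, hF⟩
  refine (Prog.meets_moveArray (by rw [hag.nats 1 (by omega), hN])).mono le_rfl ?_
  rintro s₂ ⟨hn, hr, hA⟩
  refine ⟨⟨fun k hk => ?_, fun x hx => ?_⟩, ?_, fun i hi => (hA i hi).trans (hF i hi)⟩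
  · rw [hn k (by omega), hag.nats k (by omega)]
  · rw [hr x (by omega), hag.reals x (by omega)]
  · rw [hn 5 (by omega), hag.nats 5 (by omega)]

end RealRAM

/-! ### The fast Fourier transform -/

namespace RealRAM

/-- One entry of one stage of the fast Fourier transform; cell `5` holds the new stride. -/
def Prog.butterfly : Prog :=
  .setNat (.lit 6) (.mod (.cell 4) (.cell 5)) ;;
  .setNat (.lit 7) (.sub (.cell 4) (.cell 6)) ;;
  .setNat (.lit 6) (.add (.mod (.mul (.lit 2) (.cell 7)) (.cell 1)) (.cell 6)) ;;
  .mulEntry 3 (.cell 4) 5 (.cell 7) 1 (.add (.cell 6) (.cell 5)) ;;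
  .arith .add (.arr 3 (.cell 4)) (.arr 3 (.cell 4)) (.arr 1 (.cell 6)) ;;
  .arith .add (.arr 4 (.cell 4)) (.arr 4 (.cell 4)) (.arr 2 (.cell 6))

theorem Prog.meets_butterfly {s : State} {N h i : ℕ} (hN : s.nats 1 = N) (h4 : s.nats 4 = i)
    (h5 : s.nats 5 = h) (hh : 0 < h) (hdvd : 2 * h ∣ N) (hi : i < N) :
    Prog.butterfly.WritesEntry s N 11 (s.cplx N 1 (butterflyIndex N h i) +
      s.cplx N 5 (i - i % h) * s.cplx N 1 (butterflyIndex N h i + h)) := by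
  have hlt := butterflyIndex_add_lt hdvd hi hh
  have hstate : ((s.storeNat 6 (i % h)).storeNat 7 (i - i % h)).storeNat 6
      (butterflyIndex N h i) = ⟨Function.update (Function.update s.nats 7 (i - i % h)) 6
        (butterflyIndex N h i), s.reals⟩ := by
    ext k
    · simp only [State.storeNat, Function.update_apply]
      split_ifs <;> rfl
    · rfl
  refine Prog.Meets.setNat_seq (C := 10) (Prog.Meets.setNat_seq (C := 9)
    (Prog.Meets.setNat_seq (C := 8) ?_))
  simp (disch := omega) only [NatExpr.eval, State.storeNat_nats, Function.update_of_ne,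
    Function.update_self, h4, h5, hN]
  rw [← butterflyIndex, hstate]
  generalize butterflyIndex N h i = y at hlt ⊢
  have hle : i - i % h ≤ i := Nat.sub_le _ _
  generalize i - i % h = e at hle ⊢
  refine (Prog.meets_mulEntry (N := N) (a := i) (b := e) (c := y + h) ?_ ?_ ?_ ?_ (by omega)
    (by omega) ?_).seq (C' := 2) ?_
  case refine_5 =>
    simp only [List.mem_cons, List.not_mem_nil, or_false, forall_eq_or_imp, forall_eq]
    omega
  case refine_6 =>
    rintro s' ⟨hn, hr, hz⟩
    refine ⟨by simp [Prog.cost], ?_⟩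
    simp (disch := omega) only [Prog.run, NatExpr.eval, State.storeReal_nats, hn,
      State.storeReal_reals, ArithOp.eval, Function.update_of_ne, Function.update_self, h4, hN]
    refine ⟨fun k hk => ?_, fun x h1 h2 _ => ?_, ?_⟩
    · rw [Function.update_of_ne (by omega), Function.update_of_ne (by omega)]
    · rw [Function.update_of_ne h2, Function.update_of_ne h1, hr x h1 h2 (by omega)]
    · have hsum : (s.cplx N 1 y : ℂ) + s.cplx N 5 e * s.cplx N 1 (y + h) =
          s'.cplx N 3 i + s.cplx N 1 y := by rw [hz, add_comm]; rfl
      rw [hsum]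
      apply Complex.ext <;>
        simp (disch := omega) only [State.cplx, Complex.add_re, Complex.add_im,
          State.storeReal_reals, Function.update_of_ne, Function.update_self, Nat.reduceAdd, hr]
  all_goals simp (disch := omega) only [NatExpr.eval, Function.update_of_ne, Function.update_self,
    h4, h5, hN]

/-- One stage of the fast Fourier transform. -/
def Prog.fftStage : Prog :=
  .setNat (.lit 5) (.div (.cell 5) (.lit 2)) ;; .mapArray .butterfly

/-- The fast Fourier transform of the complex array `1`. -/
def Prog.fft : Prog :=
  .setNat (.lit 5) (.cell 1) ;; .loop (.cell 2) .fftStage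

/-- Cells `1` and `2` hold `2 ^ L` and `L`, the complex array `5` holds the powers of `ω`. -/
structure FFTReady (L : ℕ) (ω : ℂ) (s : State) : Prop where
  length : s.nats 1 = 2 ^ L
  log : s.nats 2 = L
  table : ∀ i < 2 ^ L, s.cplx (2 ^ L) 5 i = ω ^ i

theorem FFTReady.of_frame {L : ℕ} {ω : ℂ} {s s' : State} (h : FFTReady L ω s)
    (hf : Frame (2 ^ L) s s') : FFTReady L ω s' := by
  refine ⟨by rw [hf.nats 1 (by omega), h.length], by rw [hf.nats 2 (by omega), h.log], ?_⟩
  intro i hi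
  rw [← h.table i hi, State.cplx, State.cplx, hf.reals _ (by omega), hf.reals _ (by omega)]

/-- The stages of the fast Fourier transform down to the stride `h` lead from `s` to `s'`. -/
structure TransformedTo (N h : ℕ) (ω : ℂ) (s s' : State) : Prop where
  frame : Frame N s s'
  stride : s'.nats 5 = h
  data : ∀ i < N, s'.cplx N 1 i = stridedDFT N h ω (s.cplx N 1) i

theorem Prog.meets_fftStage {s s' : State} {L h : ℕ} {ω : ℂ} (hs : FFTReady L ω s)
    (hω : ω ^ 2 ^ L = 1) (hpos : 0 < h) (hdvd : 2 * h ∣ 2 ^ L)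
    (ht : TransformedTo (2 ^ L) (2 * h) ω s s') :
    Prog.fftStage.Meets s' (5 + 2 ^ L * 17) (TransformedTo (2 ^ L) h ω s) := by
  refine (Prog.Meets.setNat_seq (C := 4 + 2 ^ L * (6 + 11)) ?_).mono (by omega) fun _ h => h
  simp only [NatExpr.eval, ht.stride, Nat.mul_div_cancel_left h two_pos]
  have hf := ht.frame.storeNat (k := 5) (by omega) h
  have hr := hs.of_frame hf
  refine (Prog.meets_mapArray (F := stridedDFT (2 ^ L) h ω (s.cplx (2 ^ L) 1)) hr.length
    ?_).mono le_rfl ?_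
  · intro i hi t h4 hag
    have h1 : t.nats 1 = 2 ^ L := (hag.nats 1 (by omega)).trans hr.length
    have h5 : t.nats 5 = h := by
      rw [hag.nats 5 (by omega), State.storeNat_nats, Function.update_self]
    have hlt := butterflyIndex_add_lt hdvd hi hpos
    have hdata {j : ℕ} (hj : j < 2 ^ L) :
        t.cplx (2 ^ L) 1 j = stridedDFT (2 ^ L) (2 * h) ω (s.cplx (2 ^ L) 1) j :=
      (hag.cplx_eq (Or.inl rfl) hj).trans (ht.data j hj)
    have htable {j : ℕ} (hj : j < 2 ^ L) : t.cplx (2 ^ L) 5 j = ω ^ j :=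
      (hag.cplx_eq (Or.inr rfl) hj).trans (hr.table j hj)
    rw [stridedDFT_halve hpos hdvd hω, ← hdata (by omega), ← hdata hlt, ← htable (by omega)]
    exact Prog.meets_butterfly h1 h4 h5 hpos hdvd hi
  · rintro t ⟨p1, p2, p3⟩
    exact ⟨hf.trans p1, by rw [p2, State.storeNat_nats, Function.update_self], p3⟩

theorem Prog.meets_fft {s : State} {L : ℕ} {ω : ℂ} (hs : FFTReady L ω s) (hω : ω ^ 2 ^ L = 1) :
    Prog.fft.Meets s (2 + L * (6 + 2 ^ L * 17)) fun s' =>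
      Frame (2 ^ L) s s' ∧
        ∀ i < 2 ^ L, s'.cplx (2 ^ L) 1 i = dft (2 ^ L) ω (s.cplx (2 ^ L) 1) i := by
  have hloop : (Prog.loop (.cell 2) .fftStage).Meets
      (s.storeNat 5 ((NatExpr.cell 1).eval s)) (1 + L * (1 + (5 + 2 ^ L * 17)))
      (TransformedTo (2 ^ L) (2 ^ (L - L)) ω s) := by
    refine Prog.Meets.loop (fun m => TransformedTo (2 ^ L) (2 ^ (L - m)) ω s) ?_ ?_ ?_
    · simp [NatExpr.eval, State.storeNat_nats, hs.log]
    · refine ⟨(Frame.refl _ s).storeNat (by omega) _, ?_, fun i hi => ?_⟩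
      · rw [State.storeNat_nats, Function.update_self, Nat.sub_zero, ← hs.length]
        rfl
      · rw [Nat.sub_zero, stridedDFT_self _ _ hi]
        rfl
    · intro m hm s' ht
      have hstride : 2 ^ (L - m) = 2 * 2 ^ (L - (m + 1)) := by
        rw [← pow_succ', show L - m = L - (m + 1) + 1 by omega]
      refine Prog.meets_fftStage hs hω (by positivity) ?_ (by rwa [← hstride])
      rw [← hstride]
      exact pow_dvd_pow 2 (by omega)
  refine (hloop.setNat_seq (a := .lit 5)).mono ?_ ?_
  · ring_nf
    rfl
  · rintro s' ht
    refine ⟨ht.frame, fun i hi => ?_⟩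
    rw [ht.data i hi, Nat.sub_self, pow_zero, stridedDFT_one]

/-! ### Root squaring by the machine -/

/-- Copy the real array `0` to the complex array `1`. -/
def Prog.loadPolynomial : Prog :=
  .mapArray (.copy (.arr 3 (.cell 4)) (.cell 4) ;; .setReal (.arr 4 (.cell 4)) (.lit 0))

/-- Multiply the complex array `1` entrywise by its cyclic shift by `N / 2`. -/
def Prog.mulShift : Prog :=
  .mapArray (.mulEntry 3 (.cell 4) 1 (.cell 4) 1
    (.mod (.add (.cell 4) (.div (.cell 1) (.lit 2))) (.cell 1)))

/-- Copy the real parts of the entries `-2 * i` of the complex array `1` to the array `0`. -/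
def Prog.extractEven : Prog :=
  .forUpTo (.add (.cell 0) (.lit 1)) (.copy (.cell 4)
    (.arr 1 (.mod (.sub (.cell 1) (.mul (.lit 2) (.cell 4))) (.cell 1))))

theorem Prog.meets_loadPolynomial {s : State} {N : ℕ} (hN : s.nats 1 = N) :
    Prog.loadPolynomial.Meets s (4 + N * 8) fun s' =>
      Frame N s s' ∧ ∀ i < N, s'.cplx N 1 i = (s.reals i : ℂ) := by
  refine (Prog.meets_mapArray (C := 2) (F := fun i => (s.reals i : ℂ)) hN ?_).mono (by omega)
    fun _ h => ⟨h.1, h.2.2⟩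
  intro i hi t h4 hag
  have ht1 : t.nats 1 = N := by rw [hag.nats 1 (by omega), hN]
  refine ⟨by simp [Prog.cost], ?_⟩
  simp only [Prog.run, NatExpr.eval, State.storeReal_nats, State.storeReal_reals, h4, ht1]
  refine ⟨fun _ _ => trivial, fun x h1 h2 _ => ?_, ?_⟩
  · simp (disch := omega) only [Function.update_of_ne]
  · rw [← hag.reals i (by omega)]
    apply Complex.ext <;>
      simp (disch := omega) only [State.cplx, State.storeReal_reals, Function.update_of_ne,
        Function.update_self, Nat.reduceAdd, Nat.cast_zero, Complex.ofReal_re, Complex.ofReal_im]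

theorem Prog.meets_mulShift {s : State} {N : ℕ} (hN : s.nats 1 = N) :
    Prog.mulShift.Meets s (4 + N * 12) fun s' =>
      Frame N s s' ∧ ∀ i < N, s'.cplx N 1 i = s.cplx N 1 i * s.cplx N 1 ((i + N / 2) % N) := by
  refine (Prog.meets_mapArray (C := 6)
    (F := fun i => s.cplx N 1 i * s.cplx N 1 ((i + N / 2) % N)) hN ?_).mono (by omega)
    fun _ h => ⟨h.1, h.2.2⟩
  intro i hi t h4 hag
  have ht1 : t.nats 1 = N := by rw [hag.nats 1 (by omega), hN]
  have hlt : (i + N / 2) % N < N := Nat.mod_lt _ (by omega)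
  rw [← hag.cplx_eq (Or.inl rfl) hi, ← hag.cplx_eq (Or.inl rfl) hlt]
  refine (Prog.meets_mulEntry (N := N) (a := i) (b := i) (c := (i + N / 2) % N)
    (i := .cell 4) (x := .cell 4) ht1 h4 h4 (by simp only [NatExpr.eval, h4, ht1]) (by omega)
    (by omega) ?_).mono le_rfl ?_
  · simp only [List.mem_cons, List.not_mem_nil, or_false, forall_eq_or_imp, forall_eq]
    omega
  · rintro t' ⟨hn, hr, hz⟩
    rw [h4]
    exact ⟨fun k _ => by rw [hn], fun x h1 h2 h3 => hr x h1 h2 (by omega), hz⟩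

theorem Prog.meets_extractEven {s : State} {n N : ℕ} (hn : s.nats 0 = n) (hN : s.nats 1 = N)
    (hnN : n < N) :
    Prog.extractEven.Meets s (2 + (n + 1) * 3)
      fun s' => (∀ k < 4, s'.nats k = s.nats k) ∧ (∀ x, n < x → s'.reals x = s.reals x) ∧
        ∀ i ≤ n, s'.reals i = (s.cplx N 1 ((N - 2 * i) % N)).re := by
  refine (Prog.Meets.forUpTo (m := n + 1) (C := 1) (fun m s' => (∀ k < 4, s'.nats k = s.nats k) ∧
    (∀ x, n < x → s'.reals x = s.reals x) ∧
    ∀ i < m, s'.reals i = (s.cplx N 1 ((N - 2 * i) % N)).re) ?_ ?_ ?_).mono (by omega) ?_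
  · simp [NatExpr.eval, State.storeNat_nats, hn]
  · refine ⟨fun k hk => ?_, fun x _ => rfl, fun i hi => absurd hi (by omega)⟩
    rw [State.storeNat_nats, Function.update_of_ne (by omega)]
  · rintro i hi t h4 ⟨p1, p2, p3⟩
    have ht1 : t.nats 1 = N := by rw [p1 1 (by omega), hN]
    refine ⟨le_rfl, ?_⟩
    simp only [Prog.run, NatExpr.eval, State.storeReal_nats, State.storeReal_reals,
      State.storeNat_reals, State.storeNat_nats, h4, ht1]
    refine ⟨trivial, fun k hk => ?_, fun x hx => ?_, fun j hj => ?_⟩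
    · rw [Function.update_of_ne (by omega), p1 k hk]
    · rw [Function.update_of_ne (by omega), p2 x hx]
    · rcases Nat.lt_succ_iff_lt_or_eq.1 hj with hj | rfl
      · rw [Function.update_of_ne (by omega), p3 j hj]
      · rw [Function.update_self, p2 _ (by omega)]
        rfl
  · rintro s' ⟨p1, p2, p3⟩
    exact ⟨p1, p2, fun i hi => p3 i (by omega)⟩

/-- Compute in the complex array `1` the Fourier transform of the products `f(ω^x) f(-ω^x)`, where
`f` is the polynomial in the array `0`. -/
def Prog.graeffeTransform : Prog :=
  .loadPolynomial ;; .fft ;; .mulShift ;; .fft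

/-- One squaring of the roots of the polynomial in the array `0`. -/
def Prog.squareRoots : Prog :=
  .graeffeTransform ;; .extractEven ;; .setNat (.lit 3) (.mul (.lit 2) (.cell 3))

/-- Everything is ready for squaring the roots of `q`: cell `0` holds the degree of `q`, the array
`0` its coefficients. -/
structure HoldsPolynomial (L : ℕ) (ω : ℂ) (q : ℝ[X]) (s : State) : Prop where
  ready : FFTReady L ω s
  degree : s.nats 0 = q.natDegree
  coeff : ∀ i < 2 ^ L, s.reals i = q.coeff i

theorem pow_two_pow_succ_eq_one {R : Type*} [CommRing R] {ω : R} {l : ℕ} (h : ω ^ 2 ^ l = -1) :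
    ω ^ 2 ^ (l + 1) = 1 := by
  rw [pow_succ, pow_mul, h, neg_one_sq]

theorem Prog.meets_graeffeTransform {s : State} {l : ℕ} {ω : ℂ} {q : ℝ[X]}
    (hs : HoldsPolynomial (l + 1) ω q s) (hω : ω ^ 2 ^ l = -1)
    (hn : 2 * q.natDegree < 2 ^ (l + 1)) :
    Prog.graeffeTransform.Meets s
      (12 + 2 ^ (l + 1) * 20 + 2 * ((l + 1) * (6 + 2 ^ (l + 1) * 17))) fun s' =>
      Frame (2 ^ (l + 1)) s s' ∧ ∀ i ≤ q.natDegree,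
        (s'.cplx (2 ^ (l + 1)) 1 ((2 ^ (l + 1) - 2 * i) % 2 ^ (l + 1))).re =
          (2 ^ (l + 1) : ℕ) * (graeffe q).coeff i := by
  have hω1 := pow_two_pow_succ_eq_one hω
  refine Prog.Meets.mono (C := 4 + 2 ^ (l + 1) * 8 + (2 + (l + 1) * (6 + 2 ^ (l + 1) * 17) +
    (4 + 2 ^ (l + 1) * 12 + (2 + (l + 1) * (6 + 2 ^ (l + 1) * 17))))) ?_ (by omega) fun _ h => h
  refine (Prog.meets_loadPolynomial hs.ready.length).seq ?_
  rintro s₁ ⟨f₁, a₁⟩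
  refine (Prog.meets_fft (hs.ready.of_frame f₁) hω1).seq ?_
  rintro s₂ ⟨f₂, a₂⟩
  have f₂ := f₁.trans f₂
  refine (Prog.meets_mulShift (hs.ready.of_frame f₂).length).seq ?_
  rintro s₃ ⟨f₃, a₃⟩
  have f₃ := f₂.trans f₃
  refine (Prog.meets_fft (hs.ready.of_frame f₃) hω1).mono le_rfl ?_
  rintro s₄ ⟨f₄, a₄⟩
  refine ⟨f₃.trans f₄, fun i hi => ?_⟩
  have hvalues {x : ℕ} (hx : x < 2 ^ (l + 1)) : s₂.cplx (2 ^ (l + 1)) 1 x =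
      dft (2 ^ (l + 1)) ω (q.map (algebraMap ℝ ℂ)).coeff x := by
    rw [a₂ x hx]
    refine dft_congr (fun j hj => ?_) x
    rw [a₁ j hj, hs.coeff j hj, coeff_map, Complex.coe_algebraMap]
  have hhalf : 2 ^ (l + 1) / 2 = 2 ^ l := by rw [pow_succ, Nat.mul_div_cancel _ two_pos]
  have hprod : ∀ x < 2 ^ (l + 1), s₃.cplx (2 ^ (l + 1)) 1 x =
      dft (2 ^ (l + 1)) ω (q.map (algebraMap ℝ ℂ)).coeff x *
        dft (2 ^ (l + 1)) ω (q.map (algebraMap ℝ ℂ)).coeff ((x + 2 ^ l) % 2 ^ (l + 1)) := by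
    intro x hx
    rw [a₃ x hx, hvalues hx, hvalues (Nat.mod_lt _ (by positivity)), hhalf]
  rw [a₄ _ (Nat.mod_lt _ (by positivity)), dft_congr hprod,
    dft_mul_dft_shift hω (by rwa [natDegree_map]) (by omega), ← map_graeffe, coeff_map,
    Complex.coe_algebraMap, ← Complex.ofReal_natCast, ← Complex.ofReal_mul, Complex.ofReal_re]

theorem squareRoots_cost_le {n l : ℕ} (hn : 2 * n < 2 ^ (l + 1)) :
    12 + 2 ^ (l + 1) * 20 + 2 * ((l + 1) * (6 + 2 ^ (l + 1) * 17)) + (2 + (n + 1) * 3 + 1) ≤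
      60 * 2 ^ (l + 1) * (l + 2) := by
  have hlog : l + 1 ≤ (l + 1) * 2 ^ (l + 1) := Nat.le_mul_of_pos_right _ (by positivity)
  linarith [Nat.one_le_two_pow (n := l + 1)]

theorem Prog.meets_squareRoots {s : State} {l : ℕ} {ω : ℂ} {q : ℝ[X]}
    (hs : HoldsPolynomial (l + 1) ω q s) (hω : ω ^ 2 ^ l = -1)
    (hn : 2 * q.natDegree < 2 ^ (l + 1)) (hdeg : (graeffe q).natDegree = q.natDegree) :
    Prog.squareRoots.Meets s (60 * 2 ^ (l + 1) * (l + 2)) fun s' =>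
      HoldsPolynomial (l + 1) ω (C ((2 ^ (l + 1) : ℕ) : ℝ) * graeffe q) s' ∧
        s'.nats 3 = 2 * s.nats 3 := by
  have hdeg' : (C ((2 ^ (l + 1) : ℕ) : ℝ) * graeffe q).natDegree = q.natDegree := by
    rw [natDegree_C_mul (by positivity), hdeg]
  refine Prog.Meets.mono ?_ (squareRoots_cost_le hn) fun _ h => h
  refine (Prog.meets_graeffeTransform hs hω hn).seq ?_
  rintro s₁ ⟨f, a⟩
  have hready := hs.ready.of_frame f
  refine (Prog.meets_extractEven (n := q.natDegree) (by rw [f.nats 0 (by omega), hs.degree])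
    hready.length (by omega)).seq ?_
  rintro s₂ ⟨p1, p2, p3⟩
  have hcell {k : ℕ} (hk : k < 4) : s₂.nats k = s.nats k := (p1 k hk).trans (f.nats k hk)
  refine ⟨le_rfl, ?_⟩
  simp only [Prog.run, NatExpr.eval]
  refine ⟨⟨⟨?_, ?_, fun i hi => ?_⟩, ?_, fun i hi => ?_⟩, ?_⟩
  · rw [State.storeNat_nats, Function.update_of_ne (by omega), hcell (by omega), hs.ready.length]
  · rw [State.storeNat_nats, Function.update_of_ne (by omega), hcell (by omega), hs.ready.log]
  · rw [← hready.table i hi]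
    simp only [State.cplx, State.storeNat_reals]
    rw [p2 _ (by omega), p2 _ (by omega)]
  · rw [State.storeNat_nats, Function.update_of_ne (by omega), hcell (by omega), hs.degree, hdeg']
  · rw [State.storeNat_reals]
    rcases Nat.lt_or_ge q.natDegree i with hni | hni
    · rw [p2 i hni, f.reals i (by omega), hs.coeff i hi, coeff_eq_zero_of_natDegree_lt hni,
        coeff_eq_zero_of_natDegree_lt (by rwa [hdeg'])]
    · rw [p3 i hni, a i hni, coeff_C_mul]
  · rw [State.storeNat_nats, Function.update_self, hcell (by omega)]

end RealRAM

/-! ### Roots of unity -/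

namespace RealRAM

theorem rootOp_two {x : ℝ} (hx : 0 ≤ x) : rootOp 2 x = √x := by
  rw [rootOp, if_pos ⟨by norm_num, hx⟩, Real.sqrt_eq_rpow]
  norm_num

theorem half_angle_sq {z : ℂ} (hz : ‖z‖ = 1) (him : 0 ≤ z.im) :
    (⟨√((1 + z.re) / 2), √((1 - z.re) / 2)⟩ : ℂ) ^ 2 = z := by
  have hre := abs_le.1 (hz ▸ Complex.abs_re_le_norm z)
  have hsq : z.re ^ 2 + z.im ^ 2 = 1 := by
    rw [← Complex.sq_norm_sub_sq_re, hz]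
    ring
  have h1 : 0 ≤ (1 + z.re) / 2 := by linarith
  have h2 : 0 ≤ (1 - z.re) / 2 := by linarith
  have hprod : √((1 + z.re) / 2) * √((1 - z.re) / 2) = z.im / 2 := by
    rw [← Real.sqrt_mul h1, show (1 + z.re) / 2 * ((1 - z.re) / 2) = (z.im / 2) ^ 2 by
      linear_combination -hsq / 4, Real.sqrt_sq (by linarith)]
  rw [sq]
  apply Complex.ext
  · simp only [Complex.mul_re, Real.mul_self_sqrt h1, Real.mul_self_sqrt h2]
    ring
  · simp only [Complex.mul_im]
    linear_combination 2 * hprod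

/-- Store `-1` in entry `0` of the complex array `7` and the constants `1` and `2` in the entries
`1` and `2` of the array `9`. -/
def Prog.startAngle : Prog :=
  .setReal (.arr 7 (.lit 0)) (.lit 0) ;; .setReal (.arr 8 (.lit 0)) (.lit 0) ;;
  .setReal (.arr 9 (.lit 1)) (.lit 1) ;; .setReal (.arr 9 (.lit 2)) (.lit 2) ;;
  .arith .sub (.arr 7 (.lit 0)) (.arr 7 (.lit 0)) (.arr 9 (.lit 1))

/-- Replace entry `0` of the complex array `7` by its square root, by the half-angle formulas. -/
def Prog.halveAngle : Prog :=
  .arith .sub (.arr 8 (.lit 0)) (.arr 9 (.lit 1)) (.arr 7 (.lit 0)) ;;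
  .arith .div (.arr 8 (.lit 0)) (.arr 8 (.lit 0)) (.arr 9 (.lit 2)) ;;
  .root (.arr 8 (.lit 0)) (.lit 2) (.arr 8 (.lit 0)) ;;
  .arith .add (.arr 7 (.lit 0)) (.arr 9 (.lit 1)) (.arr 7 (.lit 0)) ;;
  .arith .div (.arr 7 (.lit 0)) (.arr 7 (.lit 0)) (.arr 9 (.lit 2)) ;;
  .root (.arr 7 (.lit 0)) (.lit 2) (.arr 7 (.lit 0))

/-- Store a primitive `N`-th root of unity in entry `0` of the complex array `7`. -/
def Prog.unityRoot : Prog :=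
  .startAngle ;; .loop (.sub (.cell 2) (.lit 1)) .halveAngle

/-- In `s'`, entry `0` of the complex array `7` is a `2 ^ m`-th root of `-1` in the upper half
plane; otherwise `s'` differs from `s` only by constants in scratch memory. -/
structure AngleReady (N m : ℕ) (s s' : State) : Prop where
  nats : s'.nats = s.nats
  reals : ∀ x < 7 * N, s'.reals x = s.reals x
  one : s'.reals (9 * N + 1) = 1
  two : s'.reals (9 * N + 2) = 2
  im_nonneg : 0 ≤ (s'.cplx N 7 0).im
  pow_eq : s'.cplx N 7 0 ^ 2 ^ m = -1

theorem Prog.meets_startAngle {s : State} {N : ℕ} (hN : s.nats 1 = N) (hpos : 0 < N) :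
    Prog.startAngle.Meets s 5 (AngleReady N 0 s) := by
  refine ⟨by simp [Prog.startAngle, Prog.cost], ?_⟩
  have hrun : Prog.startAngle.run s = ((((s.storeReal (7 * N) 0).storeReal (8 * N) 0).storeReal
      (9 * N + 1) 1).storeReal (9 * N + 2) 2).storeReal (7 * N) (-1) := by
    simp (disch := omega) only [Prog.startAngle, Prog.run, NatExpr.eval, State.storeReal_nats, hN,
      State.storeReal_reals, Function.update_self, Function.update_of_ne, ArithOp.eval,
      Nat.cast_zero, Nat.cast_one, Nat.cast_ofNat, add_zero, zero_sub]
  rw [hrun]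
  constructor
  case nats => rfl
  case pow_eq =>
    simp (disch := omega) only [State.cplx, State.storeReal_reals, Function.update_self,
      Function.update_of_ne, pow_zero, pow_one, add_zero, Nat.reduceAdd]
    apply Complex.ext <;> simp
  all_goals
    intros
    simp (disch := omega) [State.cplx, State.storeReal_reals, Function.update_self,
      Function.update_of_ne]

theorem Prog.meets_halveAngle {s s' : State} {N m : ℕ} (hN : s.nats 1 = N) (hpos : 0 < N)
    (h : AngleReady N m s s') : Prog.halveAngle.Meets s' 6 (AngleReady N (m + 1) s) := by
  refine ⟨by simp [Prog.halveAngle, Prog.cost], ?_⟩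
  have hN' : s'.nats 1 = N := by rw [h.nats, hN]
  have hnorm : ‖s'.cplx N 7 0‖ = 1 :=
    Complex.norm_eq_one_of_pow_eq_one (pow_two_pow_succ_eq_one h.pow_eq) (by positivity)
  have hre := abs_le.1 (hnorm ▸ Complex.abs_re_le_norm (s'.cplx N 7 0))
  have h1 : 0 ≤ (1 + (s'.cplx N 7 0).re) / 2 := by linarith
  have h2 : 0 ≤ (1 - (s'.cplx N 7 0).re) / 2 := by linarith
  have hrun (x : ℕ) : (Prog.halveAngle.run s').reals x =
      if x = 7 * N then √((1 + (s'.cplx N 7 0).re) / 2)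
      else if x = 8 * N then √((1 - (s'.cplx N 7 0).re) / 2) else s'.reals x := by
    have hu : (s'.cplx N 7 0).re = s'.reals (7 * N) := rfl
    rw [hu] at h1 h2 ⊢
    simp (disch := omega) only [Prog.halveAngle, Prog.run, NatExpr.eval, State.storeReal_nats, hN',
      State.storeReal_reals, Function.update_self, Function.update_of_ne, ArithOp.eval, add_zero,
      h.one, h.two, rootOp_two h1, rootOp_two h2]
    simp only [Function.update_apply]
    split_ifs <;> rfl
  have hcplx : (Prog.halveAngle.run s').cplx N 7 0 =
      ⟨√((1 + (s'.cplx N 7 0).re) / 2), √((1 - (s'.cplx N 7 0).re) / 2)⟩ := by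
    rw [State.cplx, hrun, hrun, if_pos (by omega), if_neg (by omega), if_pos (by omega)]
  constructor
  case nats => rw [← h.nats]; rfl
  case reals => intro x hx; rw [hrun, if_neg (by omega), if_neg (by omega), h.reals x hx]
  case one => rw [hrun, if_neg (by omega), if_neg (by omega), h.one]
  case two => rw [hrun, if_neg (by omega), if_neg (by omega), h.two]
  case im_nonneg => rw [hcplx]; positivity
  case pow_eq => rw [hcplx, pow_succ', pow_mul, half_angle_sq hnorm h.im_nonneg, h.pow_eq]

theorem Prog.meets_unityRoot {s : State} {N l : ℕ} (hN : s.nats 1 = N) (hpos : 0 < N)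
    (hL : s.nats 2 = l + 1) : Prog.unityRoot.Meets s (6 + l * 7) (AngleReady N l s) := by
  refine ((Prog.meets_startAngle hN hpos).seq (C' := 1 + l * (1 + 6)) ?_).mono (by omega)
    fun _ h => h
  intro s₁ h₁
  refine Prog.Meets.loop (AngleReady N · s) ?_ h₁ fun i _ s' h => Prog.meets_halveAngle hN hpos h
  simp [NatExpr.eval, h₁.nats, hL]

/-- Store in the complex array `5` the powers of entry `0` of the complex array `7`. -/
def Prog.powerTable : Prog :=
  .setReal (.arr 5 (.lit 0)) (.lit 1) ;; .setReal (.arr 6 (.lit 0)) (.lit 0) ;;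
  .forUpTo (.sub (.cell 1) (.lit 1)) (.mulEntry 5 (.add (.cell 4) (.lit 1)) 5 (.cell 4) 7 (.lit 0))

/-- The complex array `5` contains the powers `0, …, m` of entry `0` of the complex array `7`, which
is the same as in `s`, and so are the parameters and the arrays `0, …, 4`. -/
structure PowersUpTo (N m : ℕ) (s s' : State) : Prop where
  nats : ∀ k < 4, s'.nats k = s.nats k
  reals : ∀ x < 5 * N, s'.reals x = s.reals x
  base : s'.cplx N 7 0 = s.cplx N 7 0
  powers : ∀ i ≤ m, s'.cplx N 5 i = s.cplx N 7 0 ^ i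

theorem Prog.meets_powerTable_step {s s' : State} {N i : ℕ} (hN : s.nats 1 = N) (hi : i < N - 1)
    (h4 : s'.nats 4 = i) (h : PowersUpTo N i s s') :
    (Prog.mulEntry 5 (.add (.cell 4) (.lit 1)) 5 (.cell 4) 7 (.lit 0)).Meets s' 6 fun s'' =>
      s''.nats 4 = i ∧ PowersUpTo N (i + 1) s (s''.storeNat 4 (i + 1)) := by
  have hN' : s'.nats 1 = N := by rw [h.nats 1 (by omega), hN]
  refine (Prog.meets_mulEntry (N := N) (a := i + 1) (b := i) (c := 0) (x := .cell 4) hN'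
    (by simp only [NatExpr.eval, h4]) h4 rfl (by omega) (by omega) ?_).mono le_rfl ?_
  · simp only [List.mem_cons, List.not_mem_nil, or_false, forall_eq_or_imp, forall_eq]
    omega
  rintro s'' ⟨hn, hr, hz⟩
  refine ⟨by rw [hn, h4], fun k hk => ?_, fun x hx => ?_, ?_, fun j hj => ?_⟩
  · rw [State.storeNat_nats, Function.update_of_ne (by omega), hn, h.nats k hk]
  · rw [State.storeNat_reals, hr x (by omega) (by omega) (by omega), h.reals x hx]
  · rw [← h.base]
    simp only [State.cplx, State.storeNat_reals]
    rw [hr _ (by omega) (by omega) (by omega), hr _ (by omega) (by omega) (by omega)]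
  · rcases Nat.le_succ_iff.1 hj with hj | rfl
    · rw [← h.powers j hj]
      simp only [State.cplx, State.storeNat_reals]
      rw [hr _ (by omega) (by omega) (by omega), hr _ (by omega) (by omega) (by omega)]
    · rw [pow_succ, ← h.powers i le_rfl, ← h.base, ← hz]
      rfl

theorem Prog.meets_powerTable {s : State} {N : ℕ} (hN : s.nats 1 = N) (hpos : 0 < N) :
    Prog.powerTable.Meets s (4 + N * 8) (PowersUpTo N (N - 1) s) := by
  refine (Prog.Meets.setReal_seq (C := 1 + (2 + (N - 1) * (2 + 6)))
    (Prog.Meets.setReal_seq (C := 2 + (N - 1) * (2 + 6)) ?_)).mono (by omega) fun _ h => h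
  simp only [NatExpr.eval, State.storeReal_nats, hN, add_zero, Nat.cast_one, Nat.cast_zero]
  refine Prog.Meets.forUpTo (fun m => PowersUpTo N m s) ?_ ?_
    fun i hi s' h4 h => Prog.meets_powerTable_step hN hi h4 h
  · simp [NatExpr.eval, State.storeNat_nats, State.storeReal_nats, hN]
  · constructor
    case powers =>
      intro i hi
      obtain rfl := Nat.le_zero.1 hi
      rw [pow_zero]
      apply Complex.ext <;> simp (disch := omega) only [State.cplx, State.storeNat_reals,
        State.storeReal_reals, Function.update_of_ne, Function.update_self, add_zero, Nat.reduceAdd,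
        Complex.one_re, Complex.one_im]
    all_goals
      intros
      simp (disch := omega) only [State.cplx, State.storeNat_reals, State.storeNat_nats,
        State.storeReal_reals, State.storeReal_nats, Function.update_of_ne]

/-! ### Raising the roots to a large power -/

/-- Store in cells `1` and `2` a power of two `N > 2 * n` and its logarithm. -/
def Prog.chooseLength : Prog :=
  .setNat (.lit 1) (.lit 2) ;; .setNat (.lit 2) (.lit 1) ;;
  .loop (.cell 0) (.ifNat (.cell 1) (.mul (.lit 2) (.cell 0))
    (.setNat (.lit 1) (.mul (.lit 2) (.cell 1)) ;; .setNat (.lit 2) (.add (.cell 2) (.lit 1)))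
    .skip)

theorem Prog.meets_chooseLength {s : State} {n : ℕ} (hn : s.nats 0 = n) (hpos : 1 ≤ n) :
    Prog.chooseLength.Meets s (3 + n * 4) fun s' => s'.nats 0 = n ∧ s'.reals = s.reals ∧
      ∃ l, s'.nats 1 = 2 ^ (l + 1) ∧ s'.nats 2 = l + 1 ∧ 2 * n < 2 ^ (l + 1) ∧
        2 ^ (l + 1) ≤ 4 * n := by
  have hloop := Prog.Meets.loop (P := .ifNat (.cell 1) (.mul (.lit 2) (.cell 0))
    (.setNat (.lit 1) (.mul (.lit 2) (.cell 1)) ;; .setNat (.lit 2) (.add (.cell 2) (.lit 1)))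
    .skip) (s := (s.storeNat 1 2).storeNat 2 1) (e := .cell 0) (m := n) (C := 3)
    (fun i s' => s'.nats 0 = n ∧ s'.reals = s.reals ∧
      ∃ l, s'.nats 1 = 2 ^ (l + 1) ∧ s'.nats 2 = l + 1 ∧ (2 * n < 2 ^ (l + 1) ∨ l = i) ∧
        2 ^ (l + 1) ≤ 4 * n) ?_ ?_ ?_
  · refine (Prog.Meets.setNat_seq (Prog.Meets.setNat_seq hloop)).mono (by omega) ?_
    rintro s' ⟨p0, pr, l, p1, p2, p3, p4⟩
    refine ⟨p0, pr, l, p1, p2, ?_, p4⟩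
    rcases p3 with h | rfl
    · exact h
    · have := Nat.lt_two_pow_self (n := l)
      rw [pow_succ]
      omega
  · simp [NatExpr.eval, State.storeNat_nats, hn]
  · refine ⟨by simp [State.storeNat_nats, hn], rfl, 0, by simp [State.storeNat_nats],
      by simp [State.storeNat_nats], Or.inr rfl, by simp; omega⟩
  · rintro i - s' ⟨p0, pr, l, p1, p2, p3, p4⟩
    refine ⟨?_, ?_⟩
    · simp only [Prog.cost]
      split_ifs <;> omega
    · simp only [Prog.run, NatExpr.eval, p0, p1]
      split_ifs with hle
      · simp (disch := omega) only [State.storeNat_nats, State.storeNat_reals,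
          Function.update_of_ne, Function.update_self, p0, p2]
        refine ⟨trivial, pr, l + 1, by ring, rfl, Or.inr (by omega), ?_⟩
        rw [pow_succ]
        omega
      · exact ⟨p0, pr, l, p1, p2, Or.inl (by omega), p4⟩

/-- Choose `N` and tabulate the powers of a primitive `N`-th root of unity. -/
def Prog.prepare : Prog :=
  .chooseLength ;; .unityRoot ;; .powerTable

theorem Prog.meets_prepare {p : ℝ[X]} (hp : 1 ≤ p.natDegree) :
    ∃ l ω, ω ^ 2 ^ l = -1 ∧ 2 * p.natDegree < 2 ^ (l + 1) ∧ 2 ^ (l + 1) ≤ 4 * p.natDegree ∧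
      Prog.prepare.Meets (inputState p) (13 + p.natDegree * 4 + l * 7 + 2 ^ (l + 1) * 8)
        (HoldsPolynomial (l + 1) ω p) := by
  obtain ⟨c₁, p0, pr, l, p1, p2, hlt, hle⟩ :=
    Prog.meets_chooseLength (s := inputState p) (n := p.natDegree) rfl hp
  obtain ⟨c₂, hangle⟩ := Prog.meets_unityRoot p1 (by positivity) p2
  obtain ⟨c₃, htable⟩ := Prog.meets_powerTable (by rw [hangle.nats, p1]) (by positivity)
  refine ⟨l, _, hangle.pow_eq, hlt, hle, ?_, ⟨?_, ?_, fun i hi => ?_⟩, ?_, fun i hi => ?_⟩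
  · simp only [Prog.prepare, Prog.cost]
    omega
  · exact (htable.nats 1 (by omega)).trans (by rw [hangle.nats, p1])
  · exact (htable.nats 2 (by omega)).trans (by rw [hangle.nats, p2])
  · exact htable.powers i (by omega)
  · exact (htable.nats 0 (by omega)).trans (by rw [hangle.nats, p0])
  · exact (htable.reals i (by omega)).trans (by rw [hangle.reals i (by omega), pr]; rfl)

/-- Square the roots of the polynomial in the array `0` as often as `e` tells and store the
exponent of the resulting power in cell `3`. -/
def Prog.iterateSquareRoots (e : NatExpr) : Prog :=
  .setNat (.lit 3) (.lit 1) ;; .loop e .squareRoots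

theorem Prog.meets_iterateSquareRoots {s : State} {p : ℝ[X]} {l k : ℕ} {ω : ℂ} {e : NatExpr}
    (hp : p ≠ 0) (hs : HoldsPolynomial (l + 1) ω p s) (hω : ω ^ 2 ^ l = -1)
    (hn : 2 * p.natDegree < 2 ^ (l + 1)) (he : e.eval (s.storeNat 3 1) = k) :
    (Prog.iterateSquareRoots e).Meets s (2 + k * (1 + 60 * 2 ^ (l + 1) * (l + 2))) fun s' =>
      ∃ q, HoldsPolynomial (l + 1) ω q s' ∧ HasPowRoots p (2 ^ k) q ∧ s'.nats 3 = 2 ^ k := by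
  refine (Prog.Meets.setNat_seq (Prog.Meets.loop
    (C := 60 * 2 ^ (l + 1) * (l + 2)) (fun m s' => ∃ q, HoldsPolynomial (l + 1) ω q s' ∧
      HasPowRoots p (2 ^ m) q ∧ s'.nats 3 = 2 ^ m) he ?_ ?_)).mono (by omega) fun _ h => h
  · refine ⟨p, ⟨⟨?_, ?_, hs.ready.table⟩, ?_, hs.coeff⟩, HasPowRoots.refl hp, ?_⟩
    · simp [NatExpr.eval, State.storeNat_nats, hs.ready.length]
    · simp [NatExpr.eval, State.storeNat_nats, hs.ready.log]
    · simp [NatExpr.eval, State.storeNat_nats, hs.degree]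
    · simp [NatExpr.eval, State.storeNat_nats]
  · rintro i - s' ⟨q, hq, hpow, h3⟩
    refine (Prog.meets_squareRoots hq hω (by rwa [hpow.natDegree_eq])
      (hpow.graeffe.natDegree_eq.trans hpow.natDegree_eq.symm)).mono le_rfl ?_
    rintro s'' ⟨hq', h3'⟩
    refine ⟨_, hq', ?_, by rw [h3', h3, pow_succ']⟩
    rw [pow_succ']
    exact hpow.graeffe.C_mul (by positivity)

/-- Replace the polynomial in the array `0` by one whose roots are the `M`-th powers of its roots,
where `M = 2 ^ (κ + (D + 1) * log₂ N)` is stored in cell `3`. -/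
def Prog.powerRoots (κ D : ℕ) : Prog :=
  .prepare ;; .iterateSquareRoots (.add (.lit κ) (.mul (.lit (D + 1)) (.cell 2)))

/-- Cell `0` holds the degree of `p`, cell `1` the length of the arrays, and the array `0` the
coefficients of the polynomial `q` whose roots are the powers of those of `p` by the number in
cell `3`. -/
structure PoweredRoots (κ D l : ℕ) (p q : ℝ[X]) (s : State) : Prop where
  hasPowRoots : HasPowRoots p (2 ^ (κ + (D + 1) * (l + 1))) q
  degree : s.nats 0 = p.natDegree
  length : s.nats 1 = 2 ^ (l + 1)
  exponent : s.nats 3 = 2 ^ (κ + (D + 1) * (l + 1))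
  coeff : ∀ i < 2 ^ (l + 1), s.reals i = q.coeff i

theorem powerRoots_cost_le {κ D n l : ℕ} (hn : 2 * n < 2 ^ (l + 1)) :
    13 + n * 4 + l * 7 + 2 ^ (l + 1) * 8 +
        (2 + (κ + (D + 1) * (l + 1)) * (1 + 60 * 2 ^ (l + 1) * (l + 2))) ≤
      100 * (κ + D + 1) * 2 ^ (l + 1) * (l + 2) ^ 2 := by
  have hk : κ + (D + 1) * (l + 1) ≤ (κ + D + 1) * (l + 2) := by nlinarith [Nat.zero_le (κ * l)]
  have hN : 0 < 2 ^ (l + 1) := by positivity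
  have h1 : 2 ^ (l + 1) ≤ 2 ^ (l + 1) * (l + 2) := Nat.le_mul_of_pos_right _ (by omega)
  have h2 : l + 2 ≤ 2 ^ (l + 1) * (l + 2) := Nat.le_mul_of_pos_left _ hN
  have h3 : 2 ^ (l + 1) * (l + 2) ≤ (κ + D + 1) * (l + 2) * (2 ^ (l + 1) * (l + 2)) :=
    Nat.le_mul_of_pos_left _ (by positivity)
  calc _ ≤ 39 * (2 ^ (l + 1) * (l + 2)) +
        (κ + (D + 1) * (l + 1)) * (61 * (2 ^ (l + 1) * (l + 2))) := by
        have : 1 + 60 * 2 ^ (l + 1) * (l + 2) ≤ 61 * (2 ^ (l + 1) * (l + 2)) := by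
          rw [mul_assoc]
          omega
        have := Nat.mul_le_mul_left (κ + (D + 1) * (l + 1)) this
        omega
    _ ≤ 39 * ((κ + D + 1) * (l + 2) * (2 ^ (l + 1) * (l + 2))) +
        (κ + D + 1) * (l + 2) * (61 * (2 ^ (l + 1) * (l + 2))) := by gcongr
    _ = _ := by ring

theorem Prog.meets_powerRoots (κ D : ℕ) {p : ℝ[X]} (hp : 1 ≤ p.natDegree) :
    ∃ l, 2 * p.natDegree < 2 ^ (l + 1) ∧ 2 ^ (l + 1) ≤ 4 * p.natDegree ∧
      (Prog.powerRoots κ D).Meets (inputState p) (100 * (κ + D + 1) * 2 ^ (l + 1) * (l + 2) ^ 2)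
        fun s => ∃ q, PoweredRoots κ D l p q s := by
  obtain ⟨l, ω, hω, hlt, hle, hprep⟩ := Prog.meets_prepare hp
  have hp0 : p ≠ 0 := ne_zero_of_natDegree_gt hp
  refine ⟨l, hlt, hle, Prog.Meets.mono (hprep.seq fun s hs => ?_) (powerRoots_cost_le hlt)
    fun _ h => h⟩
  refine (Prog.meets_iterateSquareRoots (k := κ + (D + 1) * (l + 1)) hp0 hs hω hlt ?_).mono
    le_rfl ?_
  · simp [NatExpr.eval, State.storeNat_nats, hs.ready.log]
  · rintro s' ⟨q, hq, hpow, h3⟩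
    exact ⟨q, hpow, hq.degree.trans hpow.natDegree_eq, hq.ready.length, h3, hq.coeff⟩

end RealRAM

/-! ### The Newton polygon -/

/-- The positive number at which the monomials `a u * t ^ u` and `a v * t ^ v` agree, for `u < v`
and positive `a u` and `a v`. -/
noncomputable def crossing (a : ℕ → ℝ) (u v : ℕ) : ℝ :=
  RealRAM.rootOp (v - u) (a u / a v)

section Crossing

variable {a : ℕ → ℝ} {u v : ℕ} {t : ℝ}

theorem crossing_pos (hu : 0 < a u) (hv : 0 < a v) (huv : u < v) : 0 < crossing a u v := by
  rw [crossing, RealRAM.rootOp, if_pos ⟨by omega, by positivity⟩]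
  positivity

theorem crossing_pow (hu : 0 < a u) (hv : 0 < a v) (huv : u < v) :
    crossing a u v ^ (v - u) = a u / a v := by
  rw [crossing, RealRAM.rootOp, if_pos ⟨by omega, by positivity⟩]
  exact Real.rpow_inv_natCast_pow (by positivity) (by omega)

theorem mul_pow_le_of_le_crossing (hu : 0 < a u) (hv : 0 < a v) (huv : u < v) (ht : 0 < t)
    (h : t ≤ crossing a u v) : a v * t ^ v ≤ a u * t ^ u := by
  have hpow : t ^ (v - u) ≤ a u / a v := by
    rw [← crossing_pow hu hv huv]
    exact pow_le_pow_left₀ ht.le h _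
  calc a v * t ^ v = t ^ (v - u) * a v * t ^ u := by
        rw [← pow_sub_mul_pow t huv.le]
        ring
    _ ≤ a u * t ^ u := by
        gcongr
        exact (le_div_iff₀ hv).1 hpow

theorem mul_pow_le_of_crossing_le (hu : 0 < a u) (hv : 0 < a v) (huv : u < v) (ht : 0 < t)
    (h : crossing a u v ≤ t) : a u * t ^ u ≤ a v * t ^ v := by
  have hpow : a u / a v ≤ t ^ (v - u) := by
    rw [← crossing_pow hu hv huv]
    exact pow_le_pow_left₀ (crossing_pos hu hv huv).le h _
  calc a u * t ^ u ≤ t ^ (v - u) * a v * t ^ u := by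
        gcongr
        exact (div_le_iff₀ hv).1 hpow
    _ = a v * t ^ v := by
        rw [← pow_sub_mul_pow t huv.le]
        ring

end Crossing

/-- The stack `st 0, …, st (m - 1)` holds vertices of the Newton polygon of `a 0, …, a (i - 1)`;
among them are all those that remain vertices after the addition of `a i`. -/
structure NewtonStack (a : ℕ → ℝ) (st : ℕ → ℕ) (m i : ℕ) : Prop where
  lt_next : ∀ l < m, st l < i
  mono : ∀ l, l + 1 < m → st l < st (l + 1)
  pos : ∀ l < m, 0 < a (st l)
  crossing_lt : ∀ l, l + 2 < m →
    crossing a (st l) (st (l + 1)) < crossing a (st (l + 1)) (st (l + 2))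
  dominated : ∀ u < i, ∀ t, 0 < t → ∀ B, 0 ≤ B → (∀ l < m, a (st l) * t ^ st l ≤ B) →
    a i * t ^ i ≤ B → a u * t ^ u ≤ B
  zero : ∀ u < i, m = 0 ∨ u < st 0 → a u = 0

namespace NewtonStack

variable {a : ℕ → ℝ} {st st' : ℕ → ℕ} {m i : ℕ}

theorem empty (a : ℕ → ℝ) (st : ℕ → ℕ) : NewtonStack a st 0 0 := by
  constructor <;> intros <;> omega

theorem skip (h : NewtonStack a st m i) (hi : a i = 0) : NewtonStack a st m (i + 1) := by
  refine ⟨fun l hl => (h.lt_next l hl).trans (by omega), h.mono, h.pos, h.crossing_lt, ?_, ?_⟩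
  · intro u hu t ht B hB hst _
    have hiB : a i * t ^ i ≤ B := by rwa [hi, zero_mul]
    rcases Nat.lt_succ_iff_lt_or_eq.1 hu with hu | rfl
    · exact h.dominated u hu t ht B hB hst hiB
    · exact hiB
  · intro u hu hz
    rcases Nat.lt_succ_iff_lt_or_eq.1 hu with hu | rfl
    · exact h.zero u hu hz
    · exact hi

theorem push (h : NewtonStack a st m i) (hi : 0 < a i) (hst : ∀ l < m, st' l = st l)
    (htop : st' m = i)
    (hlt : 2 ≤ m → crossing a (st (m - 2)) (st (m - 1)) < crossing a (st (m - 1)) i) :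
    NewtonStack a st' (m + 1) (i + 1) := by
  refine ⟨fun l hl => ?_, fun l hl => ?_, fun l hl => ?_, fun l hl => ?_, ?_, ?_⟩
  · rcases Nat.lt_succ_iff_lt_or_eq.1 hl with hl | rfl
    · exact hst l hl ▸ (h.lt_next l hl).trans (by omega)
    · omega
  · rw [hst l (by omega)]
    rcases Nat.lt_succ_iff_lt_or_eq.1 hl with hl | hl
    · exact hst _ hl ▸ h.mono l hl
    · exact hl ▸ htop ▸ h.lt_next l (by omega)
  · rcases Nat.lt_succ_iff_lt_or_eq.1 hl with hl | rfl
    · exact hst l hl ▸ h.pos l hl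
    · exact htop ▸ hi
  · rw [hst l (by omega), hst (l + 1) (by omega)]
    rcases Nat.lt_succ_iff_lt_or_eq.1 hl with hl | rfl
    · exact hst _ hl ▸ h.crossing_lt l hl
    · exact htop ▸ hlt (by omega)
  · intro u hu t ht B hB hB' _
    have hiB : a i * t ^ i ≤ B := htop ▸ hB' m (by omega)
    rcases Nat.lt_succ_iff_lt_or_eq.1 hu with hu | rfl
    · exact h.dominated u hu t ht B hB (fun l hl => hst l hl ▸ hB' l (by omega)) hiB
    · exact hiB
  · rintro u - (hz | hz)
    · omega
    · rcases Nat.eq_zero_or_pos m with rfl | hm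
      · exact h.zero u (htop ▸ hz) (Or.inl rfl)
      · rw [hst 0 hm] at hz
        exact h.zero u (hz.trans (h.lt_next 0 hm)) (Or.inr hz)

theorem pop (h : NewtonStack a st (m + 2) i) (hi : 0 < a i)
    (hle : crossing a (st (m + 1)) i ≤ crossing a (st m) (st (m + 1))) :
    NewtonStack a st (m + 1) i := by
  refine ⟨fun l hl => h.lt_next l (by omega), fun l hl => h.mono l (by omega),
    fun l hl => h.pos l (by omega), fun l hl => h.crossing_lt l (by omega), ?_, ?_⟩
  · intro u hu t ht B hB hB' hiB
    refine h.dominated u hu t ht B hB (fun l hl => ?_) hiB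
    rcases Nat.lt_succ_iff_lt_or_eq.1 hl with hl | rfl
    · exact hB' l hl
    have htop := h.pos (m + 1) (by omega)
    rcases le_total t (crossing a (st m) (st (m + 1))) with hc | hc
    · exact (mul_pow_le_of_le_crossing (h.pos m (by omega)) htop (h.mono m (by omega)) ht hc).trans
        (hB' m (by omega))
    · exact (mul_pow_le_of_crossing_le htop hi (h.lt_next _ (by omega)) ht (hle.trans hc)).trans hiB
  · intro u hu hz
    exact h.zero u hu (by omega)

theorem crossing_mono (h : NewtonStack a st m i) {l l' : ℕ} (hll : l ≤ l') (hl' : l' + 1 < m) :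
    crossing a (st l) (st (l + 1)) ≤ crossing a (st l') (st (l' + 1)) := by
  induction l', hll using Nat.le_induction with
  | base => rfl
  | succ k _ ih => exact (ih (by omega)).trans (h.crossing_lt k hl').le

theorem mul_pow_mono {t : ℝ} (h : NewtonStack a st m i) (ht : 0 < t) {k l : ℕ} (hkl : k ≤ l)
    (hl : l < m) (hc : ∀ b < l, crossing a (st b) (st (b + 1)) ≤ t) :
    a (st k) * t ^ st k ≤ a (st l) * t ^ st l := by
  induction l, hkl using Nat.le_induction with
  | base => rfl
  | succ b _ ih =>
    exact (ih (by omega) fun b' hb' => hc b' (by omega)).trans <|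
      mul_pow_le_of_crossing_le (h.pos b (by omega)) (h.pos _ hl) (h.mono b hl) ht (hc b (by omega))

theorem mul_pow_anti {t : ℝ} (h : NewtonStack a st m i) (ht : 0 < t) {k l : ℕ} (hlk : l ≤ k)
    (hk : k < m) (hc : ∀ b, l ≤ b → b + 1 < m → t ≤ crossing a (st b) (st (b + 1))) :
    a (st k) * t ^ st k ≤ a (st l) * t ^ st l := by
  induction k, hlk using Nat.le_induction with
  | base => rfl
  | succ b hb ih =>
    exact (mul_pow_le_of_le_crossing (h.pos b (by omega)) (h.pos _ hk) (h.mono b hk) ht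
      (hc b hb hk)).trans (ih (by omega))

theorem mul_crossing_pow_le (h : NewtonStack a st m i) {k l : ℕ} (hk : k < m) (hl : l + 1 < m) :
    a (st k) * crossing a (st l) (st (l + 1)) ^ st k ≤
      a (st l) * crossing a (st l) (st (l + 1)) ^ st l := by
  have ht := crossing_pos (h.pos l (by omega)) (h.pos _ hl) (h.mono l hl)
  rcases le_total k l with hkl | hlk
  · exact h.mul_pow_mono ht hkl (by omega) fun b hb => h.crossing_mono hb.le hl
  · exact h.mul_pow_anti ht hlk hk fun b hb hbm => h.crossing_mono hb hbm

end NewtonStack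

/-- `ρ` is the radius that the Newton polygon of `a 0, …, a n` assigns to the `j`-th largest root,
counted from `0`: the slope of the edge from `U` to `V` above `n - j`, or `0` to the left of all
vertices. -/
def IsNewtonRadius (a : ℕ → ℝ) (n j : ℕ) (ρ : ℝ) : Prop :=
  (ρ = 0 ∧ ∀ i < n - j, a i = 0) ∨
    ∃ U V, U < n - j ∧ n - j ≤ V ∧ 0 < ρ ∧
      (∀ i, a i * ρ ^ i ≤ a U * ρ ^ U) ∧ ∀ i, a i * ρ ^ i ≤ a V * ρ ^ V

theorem NewtonStack.isNewtonRadius_zero {a : ℕ → ℝ} {st : ℕ → ℕ} {m n j : ℕ}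
    (h : NewtonStack a st m (n + 1)) (hj : n - j ≤ st 0) : IsNewtonRadius a n j 0 :=
  Or.inl ⟨rfl, fun i hi => h.zero i (by omega) (Or.inr (by omega))⟩

theorem NewtonStack.isNewtonRadius_crossing {a : ℕ → ℝ} {st : ℕ → ℕ} {m n j l : ℕ}
    (h : NewtonStack a st m (n + 1)) (ha : ∀ i, n < i → a i = 0) (hl : l + 1 < m)
    (hj : st l < n - j) (hj' : n - j ≤ st (l + 1)) :
    IsNewtonRadius a n j (crossing a (st l) (st (l + 1))) := by
  have hpos := h.pos l (by omega)
  have ht := crossing_pos hpos (h.pos _ hl) (h.mono l hl)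
  have hmax (i : ℕ) : a i * crossing a (st l) (st (l + 1)) ^ i ≤
      a (st l) * crossing a (st l) (st (l + 1)) ^ st l := by
    have hbig (k : ℕ) (hk : n < k) : a k * crossing a (st l) (st (l + 1)) ^ k ≤
        a (st l) * crossing a (st l) (st (l + 1)) ^ st l := by
      rw [ha k hk, zero_mul]
      positivity
    rcases Nat.lt_or_ge n i with hi | hi
    · exact hbig i hi
    · exact h.dominated i (by omega) _ ht _ (by positivity)
        (fun k hk => h.mul_crossing_pow_le hk hl) (hbig _ (by omega))
  exact Or.inr ⟨st l, st (l + 1), hj, hj', ht, hmax, fun i => (hmax i).trans <|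
    mul_pow_le_of_crossing_le hpos (h.pos _ hl) (h.mono l hl) ht le_rfl⟩

theorem TropicallyClose.isNewtonRadius {n : ℕ} {C A : ℝ} {f : Fin n → ℝ} {a : ℕ → ℝ}
    (h : TropicallyClose C A f a) (ha : ∀ i, 0 ≤ a i) (hbig : ∀ i, n < i → a i = 0)
    (hf : ∀ j, 0 ≤ f j) {j : Fin n} {ρ : ℝ} (hρ : IsNewtonRadius a n j ρ) :
    0 ≤ ρ ∧ f j ≤ C ^ 2 * ρ ∧ ρ ≤ C ^ 2 * f j := by
  rcases hρ with ⟨rfl, hz⟩ | ⟨U, V, hU, hV, hρ, hmaxU, hmaxV⟩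
  · exact ⟨le_rfl, by simpa using h.nonpos_of_forall_lt_eq_zero ha hbig j hz,
      mul_nonneg (sq_nonneg C) (hf j)⟩
  · exact ⟨hρ.le, h.le_of_vertex j hρ hV hmaxV, h.ge_of_vertex j hρ hU hmaxU⟩

/-! ### The Newton polygon by the machine -/

namespace RealRAM

/-- Store the absolute values of the entries `0, …, n` of the array `0` in the array `1`, and `0`
in the first cell of the array `7`. -/
def Prog.absArray : Prog :=
  .setReal (.arr 7 (.lit 0)) (.lit 0) ;; .forUpTo (.add (.cell 0) (.lit 1))
    (.ifReal (.cell 4) (.arr 7 (.lit 0))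
      (.arith .sub (.arr 1 (.cell 4)) (.arr 7 (.lit 0)) (.cell 4))
      (.copy (.arr 1 (.cell 4)) (.cell 4)))

/-- The array `1` holds the weights `a 0, …, a n`, the array `7` starts with `0`, and the cells `0`,
`1`, `3` hold `n`, `N`, `M`. -/
structure HoldsWeights (n N M : ℕ) (a : ℕ → ℝ) (s : State) : Prop where
  lt : n < N
  degree : s.nats 0 = n
  length : s.nats 1 = N
  exponent : s.nats 3 = M
  entry : ∀ i ≤ n, s.reals (N + i) = a i
  zero : s.reals (7 * N) = 0

namespace HoldsWeights

variable {n N M : ℕ} {a : ℕ → ℝ} {s s' : State}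

theorem of_agree (h : HoldsWeights n N M a s) (hn : ∀ k < 4, s'.nats k = s.nats k)
    (hr : ∀ x, N ≤ x → x ≤ 7 * N → s'.reals x = s.reals x) : HoldsWeights n N M a s' := by
  have := h.lt
  refine ⟨h.lt, (hn 0 (by omega)).trans h.degree, (hn 1 (by omega)).trans h.length,
    (hn 3 (by omega)).trans h.exponent, fun i hi => ?_, ?_⟩
  · rw [hr _ (by omega) (by omega), h.entry i hi]
  · rw [hr _ (by omega) le_rfl, h.zero]

theorem storeNat (h : HoldsWeights n N M a s) {k : ℕ} (hk : 4 ≤ k) (v : ℕ) :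
    HoldsWeights n N M a (s.storeNat k v) :=
  h.of_agree (fun j hj => by rw [State.storeNat_nats, Function.update_of_ne (by omega)])
    fun _ _ _ => rfl

end HoldsWeights

theorem Prog.meets_absEntry {s : State} {N i : ℕ} (hN : s.nats 1 = N) (h4 : s.nats 4 = i)
    (hz : s.reals (7 * N) = 0) :
    (Prog.ifReal (.cell 4) (.arr 7 (.lit 0))
      (.arith .sub (.arr 1 (.cell 4)) (.arr 7 (.lit 0)) (.cell 4))
      (.copy (.arr 1 (.cell 4)) (.cell 4))).Meets s 2
      fun s' => s' = s.storeReal (N + i) |s.reals i| := by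
  refine Prog.Meets.ifReal (C := 1) (fun h => ⟨le_rfl, ?_⟩) fun h => ⟨le_rfl, ?_⟩ <;>
    simp only [NatExpr.eval, h4, hN, add_zero, hz] at h <;>
    simp only [Prog.run, NatExpr.eval, h4, hN, add_zero, hz, ArithOp.eval, zero_sub, one_mul]
  · rw [abs_of_nonpos h]
  · rw [abs_of_pos h]

theorem Prog.meets_absArray {s : State} {n N M : ℕ} (hn : s.nats 0 = n) (hN : s.nats 1 = N)
    (hM : s.nats 3 = M) (hnN : n < N) :
    Prog.absArray.Meets s (7 + n * 4) (HoldsWeights n N M fun i => |s.reals i|) := by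
  refine (Prog.Meets.setReal_seq (Prog.Meets.forUpTo (m := n + 1) (C := 2)
    (fun m s' => (∀ k < 4, s'.nats k = s.nats k) ∧ s'.reals (7 * N) = 0 ∧
      (∀ x < N, s'.reals x = s.reals x) ∧ ∀ i < m, s'.reals (N + i) = |s.reals i|)
    ?_ ?_ ?_)).mono (by omega) ?_
  · simp [NatExpr.eval, State.storeNat_nats, State.storeReal_nats, hn]
  · simp only [NatExpr.eval, hN, add_zero, State.storeNat_nats, State.storeReal_nats,
      State.storeNat_reals, State.storeReal_reals]
    refine ⟨fun k hk => ?_, ?_, fun x hx => ?_, fun i hi => absurd hi (by omega)⟩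
    · rw [Function.update_of_ne (by omega)]
    · rw [Function.update_self, Nat.cast_zero]
    · rw [Function.update_of_ne (by omega)]
  · rintro i hi s' h4 ⟨hnats, hzero, hreals, habs⟩
    refine (Prog.meets_absEntry (by rw [hnats 1 (by omega), hN]) h4 hzero).mono le_rfl ?_
    rintro _ rfl
    simp only [State.storeNat_nats, State.storeReal_nats, State.storeNat_reals,
      State.storeReal_reals]
    refine ⟨h4, fun k hk => ?_, ?_, fun x hx => ?_, fun j hj => ?_⟩
    · rw [Function.update_of_ne (by omega), hnats k hk]
    · rw [Function.update_of_ne (by omega), hzero]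
    · rw [Function.update_of_ne (by omega), hreals x hx]
    · rcases Nat.lt_succ_iff_lt_or_eq.1 hj with hj | rfl
      · rw [Function.update_of_ne (by omega), habs j hj]
      · rw [Function.update_self, hreals j (by omega)]
  · rintro s' ⟨hnats, hzero, -, habs⟩
    exact ⟨hnN, (hnats 0 (by omega)).trans hn, (hnats 1 (by omega)).trans hN,
      (hnats 3 (by omega)).trans hM, fun i hi => habs i (by omega), hzero⟩

/-- Entry `l` of the stack, counted from the bottom. -/
def State.stack (s : State) (l : ℕ) : ℕ := s.nats (16 + l)

theorem State.stack_congr {s s' : State} (h : s'.nats = s.nats) : s'.stack = s.stack := by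
  ext l
  rw [State.stack, h, State.stack]

theorem State.stack_storeNat (s : State) {k : ℕ} (hk : k < 16) (v : ℕ) :
    (s.storeNat k v).stack = s.stack := by
  ext l
  rw [State.stack, State.storeNat_nats, Function.update_of_ne (by omega), State.stack]

/-- The topmost vertex on the stack. -/
abbrev NatExpr.top : NatExpr := .load (.add (.lit 15) (.cell 5))

/-- The vertex below the topmost one. -/
abbrev NatExpr.second : NatExpr := .load (.add (.lit 14) (.cell 5))

theorem NatExpr.eval_top {s : State} {m : ℕ} (h5 : s.nats 5 = m + 1) :
    NatExpr.top.eval s = s.stack m := by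
  simp only [NatExpr.eval, h5, State.stack]
  congr 1
  omega

theorem NatExpr.eval_second {s : State} {m : ℕ} (h5 : s.nats 5 = m + 2) :
    NatExpr.second.eval s = s.stack m := by
  simp only [NatExpr.eval, h5, State.stack]
  congr 1
  omega

/-- Proceed to the next index. -/
def Prog.advance : Prog := .setNat (.lit 4) (.add (.cell 4) (.lit 1))

/-- Remove the topmost vertex from the stack. -/
def Prog.pop : Prog := .setNat (.lit 5) (.sub (.cell 5) (.lit 1))

/-- Put the current index on the stack and proceed to the next one. -/
def Prog.push : Prog :=
  .setNat (.add (.lit 16) (.cell 5)) (.cell 4) ;; .setNat (.lit 5) (.add (.cell 5) (.lit 1)) ;;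
  .advance

/-- Store in entry `k` of the array `7` the crossing of two entries of the array `1`. -/
def Prog.cross (k : ℕ) (u v : NatExpr) : Prog :=
  .arith .div (.arr 7 (.lit k)) (.arr 1 u) (.arr 1 v) ;;
  .root (.arr 7 (.lit k)) (.sub v u) (.arr 7 (.lit k))

/-- Store in the entries `1` and `2` of the array `7` the slopes of the edges that end in the
topmost vertex and in the current index. -/
def Prog.lastCrossings : Prog :=
  .cross 1 .second .top ;; .cross 2 .top (.cell 4)

/-- One step in the computation of the Newton polygon: pop a vertex that lies below the polygon, or
treat the current index. -/
def Prog.newtonStep : Prog :=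
  .ifNat (.cell 4) (.cell 0)
    (.ifReal (.arr 1 (.cell 4)) (.arr 7 (.lit 0)) .advance
      (.ifNat (.cell 5) (.lit 1) .push
        (.lastCrossings ;; .ifReal (.arr 7 (.lit 2)) (.arr 7 (.lit 1)) .pop .push)))
    .skip

theorem Prog.meets_cross {n N M : ℕ} {a : ℕ → ℝ} {s : State} (h : HoldsWeights n N M a s)
    (k : ℕ) {u v : NatExpr} (hu : u.eval s ≤ n) (hv : v.eval s ≤ n) :
    (Prog.cross k u v).Meets s 2 fun s' => s'.nats = s.nats ∧
      (∀ x, x ≠ 7 * N + k → s'.reals x = s.reals x) ∧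
      s'.reals (7 * N + k) = crossing a (u.eval s) (v.eval s) := by
  refine ⟨le_rfl, ?_⟩
  simp only [Prog.cross, Prog.run, NatExpr.eval, State.storeReal_nats, NatExpr.eval_storeReal,
    h.length, State.storeReal_reals, Function.update_self, ArithOp.eval, one_mul, h.entry _ hu,
    h.entry _ hv, crossing, true_and, and_true]
  intro x hx
  rw [Function.update_of_ne hx, Function.update_of_ne hx]

/-- The state while the Newton polygon is being computed: the current index is `i`, and there are
`m` vertices on the stack. -/
structure NewtonState (n N M : ℕ) (a : ℕ → ℝ) (i m : ℕ) (s : State) : Prop where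
  weights : HoldsWeights n N M a s
  index : s.nats 4 = i
  size : s.nats 5 = m
  stack : NewtonStack a s.stack m i
  le : i ≤ n + 1
  last : i = n + 1 → 1 ≤ m ∧ s.stack (m - 1) = n

namespace NewtonState

variable {n N M i m : ℕ} {a : ℕ → ℝ} {s s' : State}

theorem of_agree (h : NewtonState n N M a i m s) (hn : s'.nats = s.nats)
    (hr : ∀ x, N ≤ x → x ≤ 7 * N → s'.reals x = s.reals x) : NewtonState n N M a i m s' := by
  have hst := State.stack_congr hn
  exact ⟨h.weights.of_agree (fun k _ => congrFun hn k) hr, hn ▸ h.index, hn ▸ h.size,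
    hst ▸ h.stack, h.le, hst ▸ h.last⟩

theorem meets_advance (h : NewtonState n N M a i m s) (hin : i < n) (hi : a i = 0) :
    Prog.advance.Meets s 1 (NewtonState n N M a (i + 1) m) := by
  refine ⟨le_rfl, ?_⟩
  simp only [Prog.advance, Prog.run, NatExpr.eval, h.index]
  refine ⟨h.weights.storeNat le_rfl _, ?_, ?_, ?_, by omega, by omega⟩
  · rw [State.storeNat_nats, Function.update_self]
  · rw [State.storeNat_nats, Function.update_of_ne (by omega), h.size]
  · rw [State.stack_storeNat s (by omega)]
    exact h.stack.skip hi

theorem meets_push (h : NewtonState n N M a i m s) (hi : 0 < a i) (hin : i ≤ n)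
    (hlt : 2 ≤ m → crossing a (s.stack (m - 2)) (s.stack (m - 1)) <
      crossing a (s.stack (m - 1)) i) :
    Prog.push.Meets s 3 (NewtonState n N M a (i + 1) (m + 1)) := by
  refine ⟨le_rfl, ?_⟩
  have hrun : Prog.push.run s =
      ((s.storeNat (16 + m) i).storeNat 5 (m + 1)).storeNat 4 (i + 1) := by
    simp (disch := omega) only [Prog.push, Prog.advance, Prog.run, NatExpr.eval,
      State.storeNat_nats, Function.update_of_ne, h.index, h.size]
  have hstack : (Prog.push.run s).stack = (s.storeNat (16 + m) i).stack := by
    rw [hrun, State.stack_storeNat _ (by omega), State.stack_storeNat _ (by omega)]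
  have htop : (s.storeNat (16 + m) i).stack m = i := Function.update_self _ _ _
  have hbelow (l : ℕ) (hl : l < m) : (s.storeNat (16 + m) i).stack l = s.stack l := by
    rw [State.stack, State.storeNat_nats, Function.update_of_ne (by omega), State.stack]
  refine ⟨?_, ?_, ?_, ?_, by omega, fun hn => ?_⟩
  · rw [hrun]
    exact ((h.weights.storeNat (by omega) _).storeNat (by omega) _).storeNat le_rfl _
  · rw [hrun, State.storeNat_nats, Function.update_self]
  · rw [hrun, State.storeNat_nats, Function.update_of_ne (by omega), State.storeNat_nats,
      Function.update_self]
  · exact hstack ▸ h.stack.push hi hbelow htop hlt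
  · rw [hstack, Nat.add_sub_cancel, htop]
    omega

theorem meets_pop (h : NewtonState n N M a i (m + 2) s) (hin : i ≤ n) (hi : 0 < a i)
    (hle : crossing a (s.stack (m + 1)) i ≤ crossing a (s.stack m) (s.stack (m + 1))) :
    Prog.pop.Meets s 1 (NewtonState n N M a i (m + 1)) := by
  refine ⟨le_rfl, ?_⟩
  simp only [Prog.pop, Prog.run, NatExpr.eval, h.size]
  refine ⟨h.weights.storeNat (by omega) _, ?_, ?_, ?_, h.le, by omega⟩
  · rw [State.storeNat_nats, Function.update_of_ne (by omega), h.index]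
  · rw [State.storeNat_nats, Function.update_self]
    rfl
  · rw [State.stack_storeNat s (by omega)]
    exact h.stack.pop hi hle

theorem meets_lastCrossings (h : NewtonState n N M a i (m + 2) s) (hin : i ≤ n) :
    Prog.lastCrossings.Meets s 4 fun s' => NewtonState n N M a i (m + 2) s' ∧
      s'.reals (7 * N + 1) = crossing a (s'.stack m) (s'.stack (m + 1)) ∧
      s'.reals (7 * N + 2) = crossing a (s'.stack (m + 1)) i := by
  have htop := NatExpr.eval_top (s := s) (m := m + 1) h.size
  have hsecond := NatExpr.eval_second (s := s) (m := m) h.size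
  have hlt := h.stack.lt_next (m + 1) (by omega)
  have hlt' := h.stack.lt_next m (by omega)
  refine (Prog.meets_cross (u := .second) (v := .top) h.weights 1 (by omega) (by omega)).seq
    (C' := 2) ?_
  rintro s₁ ⟨hn₁, hr₁, hc₁⟩
  have h₁ : NewtonState n N M a i (m + 2) s₁ :=
    h.of_agree hn₁ fun x _ hx => hr₁ x (by omega)
  have htop₁ := NatExpr.eval_top (s := s₁) (m := m + 1) h₁.size
  have hst₁ := State.stack_congr hn₁
  refine (Prog.meets_cross (u := .top) (v := .cell 4) h₁.weights 2 (by rw [htop₁, hst₁]; omega)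
    (h₁.index.trans_le hin)).mono le_rfl ?_
  rintro s₂ ⟨hn₂, hr₂, hc₂⟩
  refine ⟨h₁.of_agree hn₂ fun x _ hx => hr₂ x (by omega), ?_, ?_⟩
  · rw [hr₂ _ (by omega), hc₁, htop, hsecond, State.stack_congr hn₂, hst₁]
  · rw [hc₂, htop₁, State.stack_congr hn₂]
    exact congrArg _ h₁.index

end NewtonState

/-- After `k` steps the Newton polygon is complete, or its computation has progressed so far that at
most `2 * (n + 1) - k` steps remain. -/
def NewtonProgress (n N M : ℕ) (a : ℕ → ℝ) (k : ℕ) (s : State) : Prop :=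
  ∃ i m, NewtonState n N M a i m s ∧ (i ≤ n → 2 * (n + 1 - i) + m + k ≤ 2 * (n + 1))

theorem Prog.meets_newtonStep {n N M k : ℕ} {a : ℕ → ℝ} {s : State} (hnn : ∀ i, 0 ≤ a i)
    (hlast : 0 < a n) (h : NewtonProgress n N M a k s) :
    Prog.newtonStep.Meets s 11 (NewtonProgress n N M a (k + 1)) := by
  obtain ⟨i, m, h, hk⟩ := h
  refine Prog.Meets.ifNat (C := 10) (fun hin => ?_)
    fun hin => ⟨Nat.zero_le _, i, m, h, fun hi => ?_⟩ <;>
    simp only [NatExpr.eval, h.index, h.weights.degree] at hin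
  swap
  · omega
  refine Prog.Meets.ifReal (C := 9) (fun hi => ?_) fun hi => ?_ <;>
    simp only [NatExpr.eval, h.index, h.weights.length, one_mul, add_zero, h.weights.zero,
      h.weights.entry i hin] at hi
  · have hi0 : a i = 0 := le_antisymm hi (hnn i)
    have hne : i ≠ n := fun hn => hlast.ne' (hn ▸ hi0)
    exact (h.meets_advance (by omega) hi0).mono (by omega) fun s' h' => ⟨_, _, h', by omega⟩
  refine Prog.Meets.ifNat (C := 8) (fun hm => ?_) fun hm => ?_ <;>
    simp only [NatExpr.eval, h.size] at hm
  · exact (h.meets_push hi hin (by omega)).mono (by omega) fun s' h' => ⟨_, _, h', by omega⟩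
  obtain ⟨m, rfl⟩ := Nat.exists_eq_add_of_le' hm
  refine (h.meets_lastCrossings hin).seq (C' := 1 + 3) ?_
  rintro s' ⟨h', hc, hc'⟩
  refine Prog.Meets.ifReal (C := 3) (fun hcmp => ?_) fun hcmp => ?_ <;>
    simp only [NatExpr.eval, h'.weights.length, hc, hc'] at hcmp
  · exact (h'.meets_pop hin hi hcmp).mono (by omega) fun s'' h'' => ⟨_, _, h'', by omega⟩
  · exact (h'.meets_push hi hin fun _ => hcmp).mono le_rfl fun s'' h'' => ⟨_, _, h'', by omega⟩

/-- Compute the Newton polygon of the array `1`. -/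
def Prog.newtonPolygon : Prog :=
  .setNat (.lit 4) (.lit 0) ;; .setNat (.lit 5) (.lit 0) ;;
  .loop (.mul (.lit 2) (.add (.cell 0) (.lit 1))) .newtonStep

theorem Prog.meets_newtonPolygon {n N M : ℕ} {a : ℕ → ℝ} {s : State} (hnn : ∀ i, 0 ≤ a i)
    (hlast : 0 < a n) (h : HoldsWeights n N M a s) :
    Prog.newtonPolygon.Meets s (27 + 24 * n) fun s' => ∃ m, NewtonState n N M a (n + 1) m s' := by
  refine (Prog.Meets.setNat_seq (Prog.Meets.setNat_seq (Prog.Meets.loop (m := 2 * (n + 1)) (C := 11)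
    (NewtonProgress n N M a) ?_ ?_ fun k _ s' hs => Prog.meets_newtonStep hnn hlast hs))).mono
    (by omega) ?_
  · simp [NatExpr.eval, State.storeNat_nats, h.degree]
  · refine ⟨0, 0, ⟨(h.storeNat (by simp [NatExpr.eval]) _).storeNat (by simp [NatExpr.eval]) _,
      ?_, ?_, NewtonStack.empty a _, by omega, by omega⟩, by omega⟩ <;>
    simp [State.storeNat_nats, NatExpr.eval]
  · rintro s' ⟨i, m, hs, hk⟩
    obtain rfl : i = n + 1 := le_antisymm hs.le (by omega)
    exact ⟨m, hs⟩

end RealRAM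

/-! ### The approximations to the root radii -/

namespace RealRAM

/-- Pop the topmost vertex if the next lower one is at least `n - i`, for the loop counter `i`. -/
def Prog.descend : Prog :=
  .ifNat (.lit 2) (.cell 5) (.ifNat (.sub (.cell 0) (.cell 4)) .second .pop .skip) .skip

/-- Store in entry `1` of the array `7` the slope of the topmost edge, or `0` without any edge. -/
def Prog.radius : Prog :=
  .ifNat (.lit 2) (.cell 5) (.cross 1 .second .top) (.setReal (.arr 7 (.lit 1)) (.lit 0))

/-- Store in the array `0`, at the position of the loop counter, the approximation to a root radius
that belongs to the slope in entry `1` of the array `7`. -/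
def Prog.scaleRoot : Prog :=
  .root (.cell 4) (.cell 3) (.arr 7 (.lit 1)) ;;
  .setReal (.arr 7 (.lit 1)) (.div (.cell 3) (.cell 1)) ;;
  .arith .mul (.cell 4) (.cell 4) (.arr 7 (.lit 1)) ;;
  .setReal (.arr 7 (.lit 1)) (.add (.div (.cell 3) (.cell 1)) (.lit 1)) ;;
  .arith .div (.cell 4) (.cell 4) (.arr 7 (.lit 1))

/-- Read the approximations to the root radii off the Newton polygon. -/
def Prog.readRadii : Prog :=
  .forUpTo (.cell 0) (.descend ;; .radius ;; .scaleRoot)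

/-- The approximation to a root radius whose `M`-th power is about `ρ`: the root of `ρ`, divided by
`1 + 1 / (M / N)` to make it a lower bound. -/
noncomputable def approxRadius (M N : ℕ) (ρ : ℝ) : ℝ :=
  rootOp M ρ * ((M / N : ℕ) : ℝ) / ((M / N + 1 : ℕ) : ℝ)

theorem Prog.meets_scaleRoot {s : State} {N M i : ℕ} (hN : s.nats 1 = N) (hM : s.nats 3 = M)
    (h4 : s.nats 4 = i) (hi : i < N) :
    Prog.scaleRoot.Meets s 5 fun s' => s'.nats = s.nats ∧
      (∀ x, x ≠ i → x ≠ 7 * N + 1 → s'.reals x = s.reals x) ∧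
      s'.reals i = approxRadius M N (s.reals (7 * N + 1)) := by
  refine ⟨le_rfl, ?_⟩
  simp (disch := omega) only [Prog.scaleRoot, Prog.run, NatExpr.eval, State.storeReal_nats, hN, hM,
    h4, State.storeReal_reals, ArithOp.eval, Function.update_self, Function.update_of_ne,
    approxRadius, true_and, and_true]
  intro x hx hx'
  simp only [Function.update_of_ne, ne_eq, hx, hx', not_false_eq_true]

/-- The state while the Newton polygon, whose `m` vertices are on the stack, is being read from
right to left: the loop counter is `i`, and the topmost remaining vertex is entry `k` of the
stack. -/
structure ReadState (n N M : ℕ) (a : ℕ → ℝ) (m i k : ℕ) (s : State) : Prop where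
  weights : HoldsWeights n N M a s
  index : s.nats 4 = i
  size : s.nats 5 = k + 1
  lt : k < m
  stack : NewtonStack a s.stack m (n + 1)
  le_top : n - i ≤ s.stack k
  below_le : ∀ l, l + 1 = k → s.stack l ≤ n - i

namespace ReadState

variable {n N M m i k : ℕ} {a : ℕ → ℝ} {s s' : State}

theorem of_agree (h : ReadState n N M a m i k s) (hn : s'.nats = s.nats)
    (hr : ∀ x, N ≤ x → x ≤ 7 * N → s'.reals x = s.reals x) : ReadState n N M a m i k s' := by
  have hst := State.stack_congr hn
  exact ⟨h.weights.of_agree (fun k _ => congrFun hn k) hr, hn ▸ h.index, hn ▸ h.size, h.lt,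
    hst ▸ h.stack, hst ▸ h.le_top, hst ▸ h.below_le⟩

theorem start (h : NewtonState n N M a (n + 1) (m + 1) s) :
    ReadState n N M a (m + 1) 0 m (s.storeNat 4 0) := by
  have hst := State.stack_storeNat s (k := 4) (by omega) 0
  have htop := (h.last rfl).2
  rw [Nat.add_sub_cancel] at htop
  refine ⟨h.weights.storeNat le_rfl _, ?_, ?_, by omega, hst ▸ h.stack, ?_, fun l hl => ?_⟩
  · rw [State.storeNat_nats, Function.update_self]
  · rw [State.storeNat_nats, Function.update_of_ne (by omega), h.size]
  · rw [hst, htop]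
    omega
  · rw [hst]
    have := h.stack.lt_next l (by omega)
    omega

theorem next (h : ReadState n N M a m i k s) (hlt : ∀ l, l + 1 = k → s.stack l < n - i) :
    ReadState n N M a m (i + 1) k (s.storeNat 4 (i + 1)) := by
  have hst := State.stack_storeNat s (k := 4) (by omega) (i + 1)
  have hle := h.le_top
  refine ⟨h.weights.storeNat le_rfl _, ?_, ?_, h.lt, hst ▸ h.stack, ?_, fun l hl => ?_⟩
  · rw [State.storeNat_nats, Function.update_self]
  · rw [State.storeNat_nats, Function.update_of_ne (by omega), h.size]
  · rw [hst]
    omega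
  · rw [hst]
    have := hlt l hl
    omega

theorem pop (h : ReadState n N M a m i (k + 1) s) (hle : n - i ≤ s.stack k) :
    ReadState n N M a m i k (s.storeNat 5 (k + 1)) ∧
      ∀ l, l + 1 = k → (s.storeNat 5 (k + 1)).stack l < n - i := by
  have hlt := h.lt
  have hst := State.stack_storeNat s (k := 5) (by omega) (k + 1)
  have hbelow (l : ℕ) (hl : l + 1 = k) : s.stack l < n - i := by
    subst hl
    exact (h.stack.mono l (by omega)).trans_le (h.below_le _ rfl)
  rw [hst]
  refine ⟨⟨h.weights.storeNat (by omega) _, ?_, ?_, by omega, hst ▸ h.stack, hst ▸ hle,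
    fun l hl => hst ▸ (hbelow l hl).le⟩, hbelow⟩
  · rw [State.storeNat_nats, Function.update_of_ne (by omega), h.index]
  · rw [State.storeNat_nats, Function.update_self]

theorem meets_descend (h : ReadState n N M a m i k s) :
    Prog.descend.Meets s 3 fun s' => s'.reals = s.reals ∧
      ∃ k, ReadState n N M a m i k s' ∧ ∀ l, l + 1 = k → s'.stack l < n - i := by
  refine Prog.Meets.ifNat (C := 2) (fun hk => ?_)
    fun hk => ⟨Nat.zero_le _, rfl, k, h, fun l hl => ?_⟩ <;>
    simp only [NatExpr.eval, h.size] at hk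
  swap
  · omega
  obtain ⟨k, rfl⟩ := Nat.exists_eq_add_of_le' (Nat.le_of_succ_le_succ hk)
  refine Prog.Meets.ifNat (C := 1) (fun hc => ⟨le_rfl, ?_⟩)
    fun hc => ⟨Nat.zero_le _, rfl, k + 1, h, fun l hl => ?_⟩ <;>
    rw [NatExpr.eval_second h.size] at hc <;>
    simp only [NatExpr.eval, h.weights.degree, h.index] at hc
  · simp only [Prog.pop, Prog.run, NatExpr.eval, h.size]
    exact ⟨rfl, k, h.pop hc⟩
  · obtain rfl : l = k := by omega
    exact hc

theorem meets_radius (h : ReadState n N M a m i k s) (ha : ∀ j, n < j → a j = 0)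
    (hlt : ∀ l, l + 1 = k → s.stack l < n - i) :
    Prog.radius.Meets s 3 fun s' => s'.nats = s.nats ∧
      (∀ x, x ≠ 7 * N + 1 → s'.reals x = s.reals x) ∧
      IsNewtonRadius a n i (s'.reals (7 * N + 1)) := by
  have hkm := h.lt
  refine Prog.Meets.ifNat (C := 2) (fun hk => ?_) fun hk => ⟨by simp [Prog.cost], ?_⟩ <;>
    simp only [NatExpr.eval, h.size] at hk
  · obtain ⟨k, rfl⟩ := Nat.exists_eq_add_of_le' (Nat.le_of_succ_le_succ hk)
    have htop := NatExpr.eval_top h.size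
    have hsecond := NatExpr.eval_second h.size
    have hle := h.stack.lt_next (k + 1) (by omega)
    have hle' := h.stack.lt_next k (by omega)
    refine (Prog.meets_cross (u := .second) (v := .top) h.weights 1 (by omega) (by omega)).mono
      le_rfl ?_
    rintro s' ⟨hn, hr, hc⟩
    refine ⟨hn, hr, ?_⟩
    rw [hc, htop, hsecond]
    exact h.stack.isNewtonRadius_crossing ha hkm (hlt k rfl) h.le_top
  · obtain rfl : k = 0 := by omega
    simp only [Prog.run, NatExpr.eval, State.storeReal_nats, State.storeReal_reals,
      h.weights.length, Function.update_self, Nat.cast_zero, true_and]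
    exact ⟨fun x hx => Function.update_of_ne hx _ _, h.stack.isNewtonRadius_zero h.le_top⟩

end ReadState

theorem Prog.meets_readRadii {n N M m : ℕ} {a : ℕ → ℝ} {s : State} (ha : ∀ j, n < j → a j = 0)
    (h : NewtonState n N M a (n + 1) m s) :
    Prog.readRadii.Meets s (2 + n * 13) fun s' =>
      ∀ j < n, ∃ ρ, IsNewtonRadius a n j ρ ∧ s'.reals j = approxRadius M N ρ := by
  obtain ⟨m, rfl⟩ := Nat.exists_eq_add_of_le' (h.last rfl).1
  have hnN := h.weights.lt
  refine (Prog.Meets.forUpTo (m := n) (C := 3 + (3 + 5))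
    (fun i s' => (∃ k, ReadState n N M a (m + 1) i k s') ∧
      ∀ j < i, ∃ ρ, IsNewtonRadius a n j ρ ∧ s'.reals j = approxRadius M N ρ)
    ?_ ⟨⟨m, .start h⟩, fun j hj => absurd hj (by omega)⟩ ?_).mono le_rfl fun s' hs => hs.2
  · simp [NatExpr.eval, State.storeNat_nats, h.weights.degree]
  rintro i hi s₀ - ⟨⟨k, h₀⟩, hdone⟩
  refine h₀.meets_descend.seq ?_
  rintro s₁ ⟨hr₁, k, h₁, hlt⟩
  refine (h₁.meets_radius ha hlt).seq ?_
  rintro s₂ ⟨hn₂, hr₂, hρ⟩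
  have h₂ : ReadState n N M a (m + 1) i k s₂ := h₁.of_agree hn₂ fun x _ _ => hr₂ x (by omega)
  refine (Prog.meets_scaleRoot h₂.weights.length h₂.weights.exponent h₂.index (by omega)).mono
    le_rfl ?_
  rintro s₃ ⟨hn₃, hr₃, hval⟩
  have h₃ : ReadState n N M a (m + 1) i k s₃ :=
    h₂.of_agree hn₃ fun x _ _ => hr₃ x (by omega) (by omega)
  refine ⟨h₃.index, ⟨k, h₃.next ?_⟩, fun j hj => ?_⟩
  · rwa [State.stack_congr (hn₃.trans hn₂)]
  · rw [State.storeNat_reals]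
    rcases Nat.lt_succ_iff_lt_or_eq.1 hj with hj | rfl
    · rw [hr₃ j (by omega) (by omega), hr₂ j (by omega), hr₁]
      exact hdone j hj
    · exact ⟨_, hρ, hval⟩

/-- Compute approximations to the root radii, with relative error at most `3 / (2 ^ κ * n ^ D)` for
a polynomial of degree `n`. -/
def Prog.rootRadii (κ D : ℕ) : Prog :=
  .powerRoots κ D ;; .absArray ;; .newtonPolygon ;; .readRadii

theorem Prog.meets_rootRadii (κ D : ℕ) {p : ℝ[X]} (hp : 1 ≤ p.natDegree) :
    ∃ l, 2 * p.natDegree < 2 ^ (l + 1) ∧ 2 ^ (l + 1) ≤ 4 * p.natDegree ∧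
      (Prog.rootRadii κ D).Meets (inputState p)
        (100 * (κ + D + 1) * 2 ^ (l + 1) * (l + 2) ^ 2 + (36 + p.natDegree * 41)) fun s =>
          ∃ q, HasPowRoots p (2 ^ (κ + (D + 1) * (l + 1))) q ∧ ∀ j < p.natDegree,
            ∃ ρ, IsNewtonRadius (fun i => |q.coeff i|) p.natDegree j ρ ∧
              s.reals j = approxRadius (2 ^ (κ + (D + 1) * (l + 1))) (2 ^ (l + 1)) ρ := by
  obtain ⟨l, hlt, hle, hpower⟩ := Prog.meets_powerRoots κ D hp
  refine ⟨l, hlt, hle, hpower.seq ?_⟩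
  rintro s₁ ⟨q, hq⟩
  have hdeg := hq.hasPowRoots.natDegree_eq
  have hlast : 0 < |q.coeff p.natDegree| := by
    rw [abs_pos, ← hdeg]
    exact leadingCoeff_ne_zero.2 hq.hasPowRoots.ne_zero
  have hbig (i : ℕ) (hi : p.natDegree < i) : |q.coeff i| = 0 := by
    rw [coeff_eq_zero_of_natDegree_lt (hdeg.trans_lt hi), abs_zero]
  refine Prog.Meets.mono ((Prog.meets_absArray hq.degree hq.length hq.exponent (by omega)).seq
    (C' := 27 + 24 * p.natDegree + (2 + p.natDegree * 13)) fun s₂ h₂ => ?_) (by omega)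
    fun _ h => ⟨q, hq.hasPowRoots, h⟩
  have hweights : HoldsWeights p.natDegree (2 ^ (l + 1)) (2 ^ (κ + (D + 1) * (l + 1)))
      (fun i => |q.coeff i|) s₂ :=
    { h₂ with entry := fun i hi => by rw [h₂.entry i hi, hq.coeff i (by omega)] }
  refine (Prog.meets_newtonPolygon (fun _ => abs_nonneg _) hlast hweights).seq ?_
  rintro s₃ ⟨m, h₃⟩
  exact Prog.meets_readRadii hbig h₃

theorem cost_rootRadii_le {G n l : ℕ} (hG : 1 ≤ G) (hn : 1 ≤ n) (hle : 2 ^ (l + 1) ≤ 4 * n) :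
    100 * G * 2 ^ (l + 1) * (l + 2) ^ 2 + (36 + n * 41) ≤
      500 * G * n * (Nat.log 2 n + 3) ^ 2 := by
  have hl : l + 2 ≤ Nat.log 2 n + 3 := by
    have hlog : l + 1 ≤ Nat.log 2 (n * 2 * 2) := Nat.le_log_of_pow_le (by norm_num) (by omega)
    rw [Nat.log_mul_base (by norm_num) (by omega),
      Nat.log_mul_base (by norm_num) (by omega)] at hlog
    omega
  have hnX : n ≤ G * (Nat.log 2 n + 3) ^ 2 * n := Nat.le_mul_of_pos_left _ (by positivity)
  calc 100 * G * 2 ^ (l + 1) * (l + 2) ^ 2 + (36 + n * 41)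
      ≤ 100 * G * (4 * n) * (Nat.log 2 n + 3) ^ 2 + 100 * (G * (Nat.log 2 n + 3) ^ 2 * n) := by
        gcongr
        omega
    _ = _ := by ring

theorem two_le_one_add_inv_pow {E : ℕ} (hE : 1 ≤ E) : (2 : ℝ) ≤ (1 + (E : ℝ)⁻¹) ^ E := by
  have hE' : (E : ℝ) ≠ 0 := by positivity
  have hinv : (0 : ℝ) ≤ (E : ℝ)⁻¹ := by positivity
  have hbernoulli := one_add_mul_le_pow (a := (E : ℝ)⁻¹) (by linarith) E
  rw [mul_inv_cancel₀ hE'] at hbernoulli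
  linarith

theorem one_add_inv_sq_le {E : ℕ} (hE : 1 ≤ E) : (1 + (E : ℝ)⁻¹) ^ 2 ≤ 1 + 3 / (E : ℝ) := by
  have hinv : (E : ℝ)⁻¹ ≤ 1 := inv_le_one_of_one_le₀ (by exact_mod_cast hE)
  have hinv0 : (0 : ℝ) ≤ (E : ℝ)⁻¹ := by positivity
  rw [div_eq_mul_inv]
  nlinarith

theorem rootOp_close {M : ℕ} {y r ρ : ℝ} (hM : 1 ≤ M) (hy : 0 ≤ y) (hr : 0 ≤ r) (hρ : 0 ≤ ρ)
    (hrρ : r ^ M ≤ y ^ M * ρ) (hρr : ρ ≤ y ^ M * r ^ M) :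
    r ≤ y * rootOp M ρ ∧ rootOp M ρ ≤ y * r := by
  have hroot : rootOp M ρ = ρ ^ ((M : ℝ)⁻¹) := if_pos ⟨hM, hρ⟩
  have hroot0 : 0 ≤ rootOp M ρ := hroot ▸ Real.rpow_nonneg hρ _
  have hrootM : rootOp M ρ ^ M = ρ := hroot ▸ Real.rpow_inv_natCast_pow hρ (by omega)
  constructor <;> refine le_of_pow_le_pow_left₀ (by omega : M ≠ 0) (by positivity) ?_ <;>
    rwa [mul_pow, hrootM]

theorem approxRadius_bounds {n N E : ℕ} (hE : 1 ≤ E) (hN : 2 * n < N) {r ρ : ℝ} (hr : 0 ≤ r)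
    (hρ : 0 ≤ ρ) (hrρ : r ^ (E * N) ≤ (2 ^ n) ^ 2 * ρ) (hρr : ρ ≤ (2 ^ n) ^ 2 * r ^ (E * N)) :
    0 ≤ approxRadius (E * N) N ρ ∧ approxRadius (E * N) N ρ ≤ r ∧
      r ≤ (1 + 3 / (E : ℝ)) * approxRadius (E * N) N ρ := by
  have hy : (0 : ℝ) < 1 + (E : ℝ)⁻¹ := by positivity
  have hyM : ((2 : ℝ) ^ n) ^ 2 ≤ (1 + (E : ℝ)⁻¹) ^ (E * N) := by
    calc ((2 : ℝ) ^ n) ^ 2 = 2 ^ (2 * n) := by rw [← pow_mul, mul_comm]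
      _ ≤ 2 ^ N := pow_le_pow_right₀ one_le_two hN.le
      _ ≤ ((1 + (E : ℝ)⁻¹) ^ E) ^ N := pow_le_pow_left₀ zero_le_two (two_le_one_add_inv_pow hE) _
      _ = (1 + (E : ℝ)⁻¹) ^ (E * N) := (pow_mul _ _ _).symm
  obtain ⟨hle, hge⟩ := rootOp_close (Nat.mul_pos hE (by omega)) hy.le hr hρ
    (hrρ.trans (by gcongr)) (hρr.trans (by gcongr))
  have hval : approxRadius (E * N) N ρ = rootOp (E * N) ρ / (1 + (E : ℝ)⁻¹) := by
    rw [approxRadius, Nat.mul_div_cancel _ (by omega)]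
    push_cast
    field_simp
  have hval0 : 0 ≤ approxRadius (E * N) N ρ :=
    hval ▸ div_nonneg (nonneg_of_mul_nonneg_right (hr.trans hle) hy) hy.le
  refine ⟨hval0, hval ▸ (div_le_iff₀' hy).2 hge, hle.trans ?_⟩
  calc (1 + (E : ℝ)⁻¹) * rootOp (E * N) ρ
      = (1 + (E : ℝ)⁻¹) ^ 2 * approxRadius (E * N) N ρ := by rw [hval]; field_simp
    _ ≤ _ := mul_le_mul_of_nonneg_right (one_add_inv_sq_le hE) hval0

theorem Prog.rootRadii_correct (κ D : ℕ) {p : ℝ[X]} (hp : 1 ≤ p.natDegree) :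
    (Prog.rootRadii κ D).Meets (inputState p)
      (500 * (κ + D + 1) * p.natDegree * (Nat.log 2 p.natDegree + 3) ^ 2) fun s =>
        ∀ j : Fin p.natDegree, 0 ≤ s.reals j ∧ s.reals j ≤ rootRadius p j ∧
          rootRadius p j ≤ (1 + 3 / ((2 : ℝ) ^ κ * (p.natDegree : ℝ) ^ D)) * s.reals j := by
  obtain ⟨l, hlt, hle, hmeets⟩ := Prog.meets_rootRadii κ D hp
  refine hmeets.mono (cost_rootRadii_le (by omega) hp hle) ?_
  rintro s ⟨q, hq, hs⟩ j
  have hM : 2 ^ (κ + (D + 1) * (l + 1)) = 2 ^ (κ + D * (l + 1)) * 2 ^ (l + 1) := by ring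
  have hE : (2 : ℝ) ^ κ * (p.natDegree : ℝ) ^ D ≤ (2 ^ (κ + D * (l + 1)) : ℕ) := by
    have hnN : (p.natDegree : ℝ) ≤ 2 ^ (l + 1) := by exact_mod_cast (by omega)
    calc (2 : ℝ) ^ κ * (p.natDegree : ℝ) ^ D ≤ 2 ^ κ * (2 ^ (l + 1)) ^ D := by gcongr
      _ = _ := by push_cast; ring
  obtain ⟨ρ, hρ, hval⟩ := hs j j.2
  obtain ⟨hρ0, hrρ, hρr⟩ := hq.tropicallyClose.isNewtonRadius (fun _ => abs_nonneg _)
    (fun i hi => by rw [coeff_eq_zero_of_natDegree_lt (hq.natDegree_eq.trans_lt hi), abs_zero])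
    (fun j => pow_nonneg (rootRadius_nonneg p j) _) hρ
  rw [hM] at hval hrρ hρr
  obtain ⟨h0, hlower, hupper⟩ :=
    approxRadius_bounds Nat.one_le_two_pow hlt (rootRadius_nonneg p j) hρ0 hrρ hρr
  rw [hval]
  exact ⟨h0, hlower, hupper.trans (by gcongr)⟩

end RealRAM

theorem isBigO_mul_natLog_add_three_sq (C : ℕ) :
    (fun n : ℕ => ((C * n * (Nat.log 2 n + 3) ^ 2 : ℕ) : ℝ)) =O[Filter.atTop]
      fun n : ℕ => (n : ℝ) * Real.log (n : ℝ) ^ 2 := by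
  refine Asymptotics.IsBigO.of_bound (C * (4 / Real.log 2) ^ 2) ?_
  filter_upwards [Filter.eventually_ge_atTop 2] with n hn
  have hlog2 : 0 < Real.log 2 := Real.log_pos one_lt_two
  have hlog : Real.log 2 ≤ Real.log n := Real.log_le_log zero_lt_two (by exact_mod_cast hn)
  have hnatLog : (Nat.log 2 n : ℝ) ≤ Real.log n / Real.log 2 := by
    simpa only [Real.logb, Nat.cast_ofNat] using Real.natLog_le_logb n 2
  have hsum : (Nat.log 2 n : ℝ) + 3 ≤ 4 / Real.log 2 * Real.log n := by
    have hone : 1 ≤ Real.log n / Real.log 2 := (one_le_div hlog2).2 hlog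
    calc (Nat.log 2 n : ℝ) + 3 ≤ 4 * (Real.log n / Real.log 2) := by linarith
      _ = _ := by ring
  rw [Real.norm_of_nonneg (by positivity), Real.norm_of_nonneg (by positivity)]
  push_cast
  calc (C : ℝ) * n * ((Nat.log 2 n : ℝ) + 3) ^ 2
      ≤ C * n * (4 / Real.log 2 * Real.log n) ^ 2 := by gcongr
    _ = _ := by ring

theorem three_div_two_pow_mul_pow_le {c d x : ℝ} {κ D : ℕ} (hc : 0 < c) (hκ : 3 / c ≤ 2 ^ κ)
    (hD : d ≤ D) (hx : 1 ≤ x) : 3 / (2 ^ κ * x ^ D) ≤ c / x ^ d := by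
  have hpow : x ^ d ≤ x ^ D := by
    rw [← Real.rpow_natCast]
    exact Real.rpow_le_rpow_of_exponent_le hx hD
  rw [← div_div]
  gcongr
  exact (div_le_comm₀ hc (by positivity)).1 hκ

theorem theoremD3 (c d : ℝ) (hc : 0 < c) :
    ∃ (P : RealRAM.Prog) (T : ℕ → ℕ),
      ((fun n : ℕ => (T n : ℝ)) =O[Filter.atTop] fun n : ℕ => (n : ℝ) * Real.log (n : ℝ) ^ 2) ∧
      ∀ p : Polynomial ℝ, 1 ≤ p.natDegree →
        P.cost (RealRAM.inputState p) ≤ T p.natDegree ∧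
        ∀ j : Fin p.natDegree,
          (P.run (RealRAM.inputState p)).reals j ≤ rootRadius p j ∧
          rootRadius p j ≤
            (1 + c / (p.natDegree : ℝ) ^ d) * (P.run (RealRAM.inputState p)).reals j := by
  obtain ⟨D, hD⟩ := exists_nat_ge d
  obtain ⟨κ, hκ⟩ := pow_unbounded_of_one_lt (3 / c) one_lt_two
  refine ⟨RealRAM.Prog.rootRadii κ D, fun n => 500 * (κ + D + 1) * n * (Nat.log 2 n + 3) ^ 2,
    isBigO_mul_natLog_add_three_sq _, fun p hp => ?_⟩
  obtain ⟨hcost, hradii⟩ := RealRAM.Prog.rootRadii_correct κ D hp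
  refine ⟨hcost, fun j => ?_⟩
  obtain ⟨hnonneg, hlower, hupper⟩ := hradii j
  refine ⟨hlower, hupper.trans (mul_le_mul_of_nonneg_right (add_le_add_right ?_ 1) hnonneg)⟩
  exact three_div_two_pow_mul_pow_le hc hκ.le hD (by exact_mod_cast hp)
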